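/- Let $X$ and $X_0$ be smooth projective absolutely irreducible curves over a finite field $\mathbb F_q$, let $f,g\colon X\to X_0$ be two nonconstant morphisms over $\mathbb F_q$, both of degree $d$. Write $X(\overline{\mathbb F}_q)$ and $X_0(\overline{\mathbb F}_q)$ for the sets of geometric points, $e_f(P)$ and $e_g(P)$ for the ramification indices at $P\in X(\overline{\mathbb F}_q)$; the ramification locus of $g$ in $X_0(\overline{\mathbb F}_q)$ is the set of all $g(P)$ with $e_g(P)>1$. For a finite set $T$ of geometric points put $\operatorname{div}(T)=\sum_{P\in T}P$, and for a finite set $S_0\subset X_0(\overline{\mathbb F}_q)$ put $$\mathfrak D_f(S_0)=\sum_{P\in f^{-1}(S_0)}(e_f(P)-1)P,\qquad \mathfrak D_g(S_0)=\sum_{P\in g^{-1}(S_0)}(e_g(P)-1)P .$$ A set $S\subset X(\overline{\mathbb F}_q)$ is complete if $g^{-1}(f(S))\subset S$ and $f^{-1}(g(S))\subset S$. It is $d$-regular if it is finite and in the directed graph with vertex set $S$ and with an edge from $P$ to $Q$ whenever $f(P)=g(Q)$, every vertex has in-degree $d$ and out-degree $d$. For nonzero $u,v\in\mathbb F_q(X)$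 write $u\sim v$ if $u=cv$ for some $c\in\mathbb F_q^*$. **Theorem (functional regularness criterion).** Let $S_0\subset X_0(\overline{\mathbb F}_q)$ be finite and let $S=f^{-1}(S_0)=g^{-1}(S_0)$ be a complete set. Let $b$ be the order of the degree zero divisor $\mathfrak D_f(S_0)-\mathfrak D_g(S_0)$ in $\operatorname{Jac}(X)$, i.e. the least integer $b\ge 1$ such that $b(\mathfrak D_f(S_0)-\mathfrak D_g(S_0))$ is the divisor of a function on $X$ over $\overline{\mathbb F}_q$, and let $\rho\in\mathbb F_q(X)$ be a nonzero function with $\operatorname{div}(\rho)=b(\mathfrak D_f(S_0)-\mathfrak D_g(S_0))$. Let $T_0\subset X_0(\overline{\mathbb F}_q)$ be a finite set, disjoint from the ramification locus of $g$. Let $s,t\ge 1$ be integers such that $t\,\sharp S_0=s\,\sharp T_0$, let $a$ be the order of the degree zero divisor $s\operatorname{div}(T_0)-t\operatorname{div}(S_0)$ in $\operatorname{Jac}(X_0)$, and let $\varphi\in\mathbb F_q(X_0)$ be a nonzero function with $\operatorname{div}(\varphi)=a\,(s\operatorname{div}(T_0)-t\operatorname{div}(S_0))$. Then $$\rho^{ta}\,(\varphi\circ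 f)^b\ \sim\ (\varphi\circ g)^b\quad\text{in }\mathbb F_q(X)$$ if and only if $f^{-1}(T_0)$ is $d$-regular. -/

import Mathlib

open CategoryTheory CategoryTheory.Limits AlgebraicGeometry

universe u

noncomputable section

namespace RecursiveTower

section FunctionFieldMap

variable {X Y : Scheme.{u}} [IsIntegral X] [IsIntegral Y]

theorem map_genericPoint (f : X ⟶ Y) [IsDominant f] : f (genericPoint X) = genericPoint Y := by
  apply ((genericPoint_spec Y).eq _).symm
  have h := (genericPoint_spec X).image f.continuous
  rw [Set.image_univ, f.denseRange.closure_range] at h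
  exact h

/-- The pullback `φ ↦ φ ∘ f` of rational functions along a dominant morphism of integral
schemes. -/
def pullbackFun (f : X ⟶ Y) [IsDominant f] : Y.functionField →+* X.functionField :=
  (Y.presheaf.stalkSpecializes (specializes_of_eq (map_genericPoint f)) ≫
    f.stalkMap (genericPoint X)).hom

end FunctionFieldMap

/-- A smooth projective absolutely irreducible curve over the field `k` (for smooth curves over a
field, proper is the same as projective). -/
structure Curve (k : Type u) [Field k] where
  /-- the underlying scheme -/
  X : Scheme.{u}
  /-- the structure morphism -/
  str : X ⟶ Spec (.of k)
  [smooth : SmoothOfRelativeDimension 1 str]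
  [proper : IsProper str]
  [geometricallyIntegral : GeometricallyIntegral str]

attribute [instance] Curve.smooth Curve.proper Curve.geometricallyIntegral

variable {k : Type u} [Field k]

/-- The morphism `Spec k̄ ⟶ Spec k`, where `k̄` is an algebraic closure of `k`. -/
abbrev specClosure (k : Type u) [Field k] : Spec (.of (AlgebraicClosure k)) ⟶ Spec (.of k) :=
  Spec.map (CommRingCat.ofHom (algebraMap k (AlgebraicClosure k)))

instance : Surjective (specClosure k) :=
  ⟨Function.surjective_to_subsingleton (α := Spec (.of (AlgebraicClosure k))) (β := Spec (.of k)) _⟩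

namespace Curve

variable (C : Curve k)

instance : IsIntegral C.X := GeometricallyIntegral.isIntegral_of_subsingleton C.str

/-- The curve `C ×ₖ k̄`. -/
abbrev geom : Scheme.{u} := pullback C.str (specClosure k)

instance : IsIntegral C.geom :=
  GeometricallyIntegral.isIntegral_of_subsingleton (pullback.snd C.str (specClosure k))

instance : IsLocallyNoetherian C.geom :=
  LocallyOfFiniteType.isLocallyNoetherian (pullback.snd C.str (specClosure k))

/-- The projection `C ×ₖ k̄ ⟶ C`. -/
abbrev proj : C.geom ⟶ C.X := pullback.fst C.str (specClosure k)

/-- The field `k(C)` of rational functions defined over `k`. -/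
abbrev FunField : Type u := C.X.functionField

/-- The field `k̄(C)`. -/
abbrev GeomFunField : Type u := C.geom.functionField

/-- The inclusion `k(C) → k̄(C)`. -/
def toGeom : C.FunField →+* C.GeomFunField := pullbackFun C.proj

/-- The inclusion `k → k(C)` of the constants. -/
def const : k →+* C.FunField :=
  ((Scheme.ΓSpecIso (.of k)).inv ≫ C.str.appTop ≫
    C.X.presheaf.germ ⊤ (genericPoint C.X) (TopologicalSpace.Opens.mem_top _)).hom

/-- The set `C(k̄)` of geometric points: the `k`-morphisms `Spec k̄ ⟶ C`. -/
@[ext]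
structure Pt : Type u where
  /-- the morphism `Spec k̄ ⟶ C` -/
  hom : Spec (.of (AlgebraicClosure k)) ⟶ C.X
  w : hom ≫ C.str = specClosure k

variable {C} in
/-- The section of `C ×ₖ k̄ ⟶ Spec k̄` given by a geometric point of `C`. -/
def Pt.toSection (P : C.Pt) : Spec (.of (AlgebraicClosure k)) ⟶ C.geom :=
  pullback.lift P.hom (𝟙 _) (by rw [P.w, Category.id_comp])

variable {C} in
/-- The closed point of `C ×ₖ k̄` given by a geometric point of `C`. -/
def Pt.toGeom (P : C.Pt) : C.geom := P.toSection (IsLocalRing.closedPoint (AlgebraicClosure k))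

/-- The group `Div(C)` of divisors of `C` over `k̄`. -/
abbrev Div : Type u := C.Pt →₀ ℤ

/-- The divisor of a nonzero element of `k̄(C)`, as a function on `C(k̄)`. -/
def geomDiv (h : C.GeomFunField) (P : C.Pt) : ℤ := Scheme.ord h P.toGeom

/-- The divisor of a nonzero element of `k(C)`, as a function on `C(k̄)`. -/
def div (φ : C.FunField) : C.Pt → ℤ := C.geomDiv (C.toGeom φ)

theorem geomDiv_one (P : C.Pt) : C.geomDiv 1 P = 0 := by
  have h := Scheme.ord_mul (X := C.geom) (x := P.toGeom) one_ne_zero one_ne_zero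
  rw [mul_one] at h
  simpa [geomDiv] using h

/-- The group of the divisors of nonzero rational functions on `C ×ₖ k̄`. -/
def principalDivisors : AddSubgroup C.Div where
  carrier := {D | ∃ h : C.GeomFunField, h ≠ 0 ∧ C.geomDiv h = ⇑D}
  zero_mem' := ⟨1, one_ne_zero, funext C.geomDiv_one⟩
  add_mem' := by
    rintro D E ⟨h, hh, hD⟩ ⟨l, hl, hE⟩
    refine ⟨h * l, mul_ne_zero hh hl, funext fun P ↦ ?_⟩
    rw [Finsupp.add_apply, ← hD, ← hE]
    exact Scheme.ord_mul hh hl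
  neg_mem' := by
    rintro D ⟨h, hh, hD⟩
    refine ⟨h⁻¹, inv_ne_zero hh, funext fun P ↦ ?_⟩
    have h1 : C.geomDiv (h * h⁻¹) P = C.geomDiv h P + C.geomDiv h⁻¹ P :=
      Scheme.ord_mul hh (inv_ne_zero hh)
    rw [mul_inv_cancel₀ hh, C.geomDiv_one] at h1
    rw [Finsupp.neg_apply, ← hD]
    omega

/-- The group of divisor classes of `C ×ₖ k̄`. -/
abbrev Pic : Type u := C.Div ⧸ C.principalDivisors

variable {C} in
/-- The (degree zero) divisor `D` has order `n` in the jacobian of `C`. The group `Jac(C)(k̄)` is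
the subgroup of `Pic` of the classes of degree zero, so the order is the order in `Pic`. -/
def HasOrderInJac (D : C.Div) (n : ℕ) : Prop :=
  IsLeast {m : ℕ | 0 < m ∧ m • (QuotientAddGroup.mk D : C.Pic) = 0} n

variable {C} in
/-- The reduced divisor `div(S) = ∑_{P ∈ S} P` of a finite set `S` of geometric points. -/
def setDiv (S : Finset C.Pt) : C.Div := ∑ P ∈ S, Finsupp.single P 1

variable {C} in
/-- `φ ∼ ψ`: the two functions are equal up to a nonzero constant of `k`. -/
def EqUpToConst (φ ψ : C.FunField) : Prop := ∃ c : k, c ≠ 0 ∧ φ = C.const c * ψ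

/-- A nonconstant morphism of curves over `k`. -/
structure Map (C D : Curve k) where
  /-- the underlying morphism of schemes -/
  hom : C.X ⟶ D.X
  w : hom ≫ D.str = C.str
  [dominant : IsDominant hom]

attribute [instance] Map.dominant

namespace Map

variable {C D : Curve k} (f : C.Map D)

/-- The pullback `φ ↦ φ ∘ f` of rational functions. -/
def comap : D.FunField →+* C.FunField := pullbackFun f.hom

/-- The degree `[k(C) : k(D)]` of `f`. -/
def degree : ℕ :=
  letI := f.comap.toAlgebra
  Module.finrank D.FunField C.FunField

/-- The base change of `f` to `k̄`. -/
def geom : C.geom ⟶ D.geom :=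
  pullback.lift (C.proj ≫ f.hom) (pullback.snd C.str (specClosure k))
    (by rw [Category.assoc, f.w, pullback.condition])

/-- The action of `f` on geometric points. -/
def onPts (P : C.Pt) : D.Pt := ⟨P.hom ≫ f.hom, by rw [Category.assoc, f.w, P.w]⟩

/-- The ramification index `e_f(P)`. -/
def ramIdx (P : C.Pt) : ℕ :=
  letI := (f.geom.stalkMap P.toGeom).hom.toAlgebra
  (IsLocalRing.maximalIdeal (C.geom.presheaf.stalk P.toGeom)).ramificationIdx
    (D.geom.presheaf.stalk (f.geom P.toGeom))

/-- The ramification locus of `f` in the base curve: the images of the ramified points. -/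
def ramLocus : Set D.Pt := f.onPts '' {P | 1 < f.ramIdx P}

/-- The restricted different divisor `𝔇_f(S₀) = ∑_{P ∈ f⁻¹(S₀)} (e_f(P) - 1) P`. -/
def different (S₀ : Finset D.Pt) : C.Div :=
  ∑ᶠ P ∈ f.onPts ⁻¹' (S₀ : Set D.Pt), Finsupp.single P ((f.ramIdx P : ℤ) - 1)

end Map

variable {C} {D : Curve k} (f g : C.Map D)

/-- The geometric graph of the correspondence `Γ_{f,g} = {(P, Q) ; f(P) = g(Q)}`. -/
def geometricGraph : Digraph C.Pt where
  Adj P Q := f.onPts P = g.onPts Q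

/-- The set `S` is finite and every vertex of the subgraph of the geometric graph with set of
vertices `S` has in and out degrees equal to `d`. -/
def IsDRegular (d : ℕ) (S : Set C.Pt) : Prop :=
  S.Finite ∧ ∀ P ∈ S,
    {Q ∈ S | (geometricGraph f g).Adj P Q}.encard = d ∧
    {Q ∈ S | (geometricGraph f g).Adj Q P}.encard = d

/-- The set `S` is forward complete, `g⁻¹(f(S)) ⊆ S`, and backward complete, `f⁻¹(g(S)) ⊆ S`. -/
def IsComplete (S : Set C.Pt) : Prop :=
  g.onPts ⁻¹' (f.onPts '' S) ⊆ S ∧ f.onPts ⁻¹' (g.onPts '' S) ⊆ S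

end Curve

end RecursiveTower

end

/-!
On a proper smooth curve a rational function is determined up to a constant by its divisor, so the
relation `ρ ^ (t a) (φ ∘ f) ^ b ∼ (φ ∘ g) ^ b` is an equality of divisors. The divisor of `φ ∘ f` at
`P` is `e_f(P)` times that of `φ` at `f(P)` (`Curve.Map.div_comap`). Since `S = f⁻¹(S₀) = g⁻¹(S₀)`,
the terms `f^* div(S₀)` and `g^* div(S₀)` differ by `𝔇_f(S₀) - 𝔇_g(S₀)`, which the divisor of
`ρ ^ (t a)` compensates, and the relation becomes `f^* div(T₀) = g^* div(T₀)`
(`Curve.eqUpToConst_iff_pullback_setDiv_eq`).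

As `g` is unramified above `T₀`, this equality says that `f⁻¹(T₀) = g⁻¹(T₀)` and that `f` too is
unramified above `T₀`. By the fundamental identity `∑ e_f(P) = d` on the fibres of `f` and `g`, a
fibre has at most `d` points, with equality exactly when it is unramified. So the condition amounts
to the regularity of `f⁻¹(T₀)` (`Curve.pullback_setDiv_eq_iff_isDRegular`).

The geometry needed is proved for proper smooth integral curves over an algebraically closed field:
the local rings at closed points are discrete valuation rings (`isDiscreteValuationRing_stalk`),
nonconstant morphisms are finite and satisfy the fundamental identity
(`finite_fiber_and_sum_ramIdxAt`), and functions without zeros and poles are constant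
(`exists_eq_constStalk_of_ord_eq_zero`). The passage between `k` and its algebraic closure `k̄`
rests on `k̄(C) = k(C) ⊗ k̄` (`Curve.isPushout_funField`): it preserves the degree of a morphism
(`Curve.Map.finrank_geom`), and a function over `k` that is constant over `k̄` is a constant of `k`
(`Curve.exists_eq_const_of_toGeom_eq`).
-/

noncomputable section

/-! ### Discrete valuation rings and ramification indices -/

section LocalAlgebra

open IsLocalRing TensorProduct

/-- A local ring of a smooth algebra of relative dimension one over a field `k`, with residue field
`k`, is a discrete valuation ring: its cotangent space is the fibre of the module of differentials,
which is free of rank one. -/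
theorem IsLocalRing.isDiscreteValuationRing_of_isStandardSmooth
    {k A R : Type*} [Field k] [CommRing A] [CommRing R] [IsDomain R] [IsLocalRing R]
    [IsNoetherianRing R] [Algebra k A] [Algebra A R] [Algebra k R] [IsScalarTower k A R]
    [Algebra.IsStandardSmoothOfRelativeDimension 1 k A]
    (M : Submonoid A) [IsLocalization M R]
    (h : Function.Surjective (algebraMap k (ResidueField R))) :
    IsDiscreteValuationRing R := by
  have hst : Algebra.IsStandardSmooth k A :=
    Algebra.IsStandardSmoothOfRelativeDimension.isStandardSmooth 1
  have : Nontrivial A := (algebraMap A R).domain_nontrivial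
  have : Algebra.FormallyEtale A R := .of_isLocalization M
  have : Algebra.FormallySmooth k R := .comp k A R
  have hκ : Function.Bijective (algebraMap k (ResidueField R)) :=
    ⟨(algebraMap k (ResidueField R)).injective, h⟩
  have : Algebra.FormallyEtale k (ResidueField R) :=
    .of_equiv (AlgEquiv.ofBijective (Algebra.ofId k (ResidueField R)) hκ)
  have hsurj : Function.Surjective (algebraMap R (ResidueField R)) := residue_surjective
  have hinj : Function.Injective
      (KaehlerDifferential.kerCotangentToTensor k R (ResidueField R)) :=
    (Algebra.FormallySmooth.kerCotangentToTensor_injective_iff hsurj).mpr inferInstance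
  -- the conormal sequence is `0 → 𝔪/𝔪² → κ ⊗ Ω[R⁄k] → Ω[κ⁄k] = 0`
  have hex := KaehlerDifferential.exact_kerCotangentToTensor_mapBaseChange k R (ResidueField R)
    hsurj
  have hsur : Function.Surjective
      (KaehlerDifferential.kerCotangentToTensor k R (ResidueField R)) := fun y ↦
    (hex y).mp (Subsingleton.elim _ _)
  have e1 := LinearEquiv.ofBijective _ ⟨hinj, hsur⟩
  rw [← finrank_CotangentSpace_eq_one_iff]
  have hker : RingHom.ker (algebraMap R (ResidueField R)) = maximalIdeal R := ker_residue
  rw [hker] at e1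
  have e2 : CotangentSpace R ≃ₗ[ResidueField R] ResidueField R ⊗[R] Ω[R⁄k] :=
    LinearEquiv.extendScalarsOfSurjective hsurj e1
  rw [e2.finrank_eq]
  have e3 := KaehlerDifferential.tensorKaehlerEquivOfFormallyEtale k A R
  have : Module.Free R Ω[R⁄k] := .of_equiv e3
  rw [Module.finrank_baseChange, ← e3.finrank_eq, Module.finrank_baseChange, Module.finrank,
    Algebra.IsStandardSmoothOfRelativeDimension.rank_kaehlerDifferential 1]
  simp

theorem IsLocalRing.map_maximalIdeal_eq_pow_ramificationIdx {R S : Type*} [CommRing R]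
    [CommRing S] [IsDomain R] [IsDomain S] [IsDiscreteValuationRing R] [IsDiscreteValuationRing S]
    [Algebra R S] [IsLocalHom (algebraMap R S)] [FaithfulSMul R S] :
    (maximalIdeal R).map (algebraMap R S) =
      maximalIdeal S ^ (maximalIdeal S).ramificationIdx R := by
  have hbot : (maximalIdeal R).map (algebraMap R S) ≠ ⊥ := by
    rw [Ne, Ideal.map_eq_bot_iff_of_injective (FaithfulSMul.algebraMap_injective R S)]
    exact IsDiscreteValuationRing.not_a_field R
  have htfae : IsDiscreteValuationRing S ↔ ∀ I : Ideal S, I ≠ ⊥ → ∃ n : ℕ, I = maximalIdeal S ^ n :=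
    (IsDiscreteValuationRing.TFAE S (IsDiscreteValuationRing.not_isField S)).out 0 6
  obtain ⟨n, hn⟩ := htfae.mp ‹_› _ hbot
  have : (maximalIdeal S).LiesOver (maximalIdeal R) := inferInstance
  rw [← Ideal.ramificationIdx'_eq_ramificationIdx' (maximalIdeal R) (maximalIdeal S) hbot]
  rw [Ideal.ramificationIdx'_spec (n := n) hn.le, hn]
  rw [hn]
  intro h
  exact (Ideal.pow_succ_lt_pow (IsDiscreteValuationRing.not_a_field S) n).not_ge h

/-- The valuation of a discrete valuation ring restricts to the power of the valuation below it
given by the ramification index. -/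
theorem Ring.ordFrac_algebraMap_eq_pow {R S F L : Type*} [CommRing R]
    [CommRing S] [IsDomain R] [IsDomain S] [IsDiscreteValuationRing R] [IsDiscreteValuationRing S]
    [Algebra R S] [IsLocalHom (algebraMap R S)] [FaithfulSMul R S] [Field F] [Field L]
    [Algebra R F] [IsFractionRing R F] [Algebra S L] [IsFractionRing S L]
    (i : F →+* L) (hi : ∀ r : R, i (algebraMap R F r) = algebraMap S L (algebraMap R S r)) {x : F}
    (hx : x ≠ 0) :
    Ring.ordFrac S (i x) = Ring.ordFrac R x ^ (maximalIdeal S).ramificationIdx R := by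
  obtain ⟨π, hπ⟩ := IsDiscreteValuationRing.exists_irreducible R
  obtain ⟨ϖ, hϖ⟩ := IsDiscreteValuationRing.exists_irreducible S
  set e := (maximalIdeal S).ramificationIdx R with he
  have hass : Associated (algebraMap R S π) (ϖ ^ e) := by
    rw [← Ideal.span_singleton_eq_span_singleton, ← Ideal.span_singleton_pow, ← hϖ.maximalIdeal_eq,
      ← IsLocalRing.map_maximalIdeal_eq_pow_ramificationIdx (R := R), hπ.maximalIdeal_eq,
      Ideal.map_span, Set.image_singleton]
  obtain ⟨u, hu⟩ := hass.symm
  have key (r : R) (hr : r ≠ 0) : Ring.ordFrac S (i (algebraMap R F r)) =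
      Ring.ordFrac R (algebraMap R F r) ^ e := by
    obtain ⟨m, v, rfl⟩ := IsDiscreteValuationRing.eq_unit_mul_pow_irreducible hr hπ
    rw [hi]
    simp only [map_mul, map_pow]
    rw [← hu]
    have h1 : Ring.ordFrac S (algebraMap S L (algebraMap R S v)) = 1 :=
      Ring.ordFrac_of_isUnit (v.isUnit.map _)
    simp only [map_mul, map_pow]
    rw [h1, Ring.ordFrac_of_isUnit u.isUnit, Ring.ordFrac_of_isUnit v.isUnit,
      Ring.ordFrac_irreducible hϖ, Ring.ordFrac_irreducible hπ]
    simp [mul_comm]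
  obtain ⟨a, b, hb, rfl⟩ := IsFractionRing.div_surjective (A := R) x
  have ha : a ≠ 0 := by
    rintro rfl
    simp at hx
  rw [map_div₀, map_div₀, map_div₀, key a ha, key b (nonZeroDivisors.ne_zero hb), div_pow]

/-- Localising at a prime above and a prime below does not change the ramification index. -/
theorem Ideal.ramificationIdx_eq_of_isLocalization {A B R S : Type*} [CommRing A] [CommRing B]
    [CommRing R] [CommRing S] [IsLocalRing R] [IsLocalRing S] [Algebra A B] [Algebra A R]
    [Algebra B S] [Algebra R S] [Algebra A S] [IsScalarTower A B S] [IsScalarTower A R S]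
    [IsLocalHom (algebraMap R S)] [Module.Flat R S]
    (p : Ideal A) [p.IsPrime] (q : Ideal B) [q.IsPrime] [IsLocalization.AtPrime R p]
    [IsLocalization.AtPrime S q] :
    (maximalIdeal S).ramificationIdx R = q.ramificationIdx A := by
  have h1 : (maximalIdeal R).ramificationIdx A = 1 := by
    have : Algebra.FormallyUnramified A R := .of_isLocalization p.primeCompl
    have : Algebra.EssFiniteType A R := .of_isLocalization _ p.primeCompl
    exact Ideal.ramificationIdx_eq_one _ _
  have h2 : (maximalIdeal S).ramificationIdx B = 1 := by
    have : Algebra.FormallyUnramified B S := .of_isLocalization q.primeCompl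
    have : Algebra.EssFiniteType B S := .of_isLocalization _ q.primeCompl
    exact Ideal.ramificationIdx_eq_one _ _
  have : (maximalIdeal S).LiesOver q := IsLocalization.AtPrime.liesOver_maximalIdeal S q _
  have : Module.Flat B S := IsLocalization.flat S q.primeCompl
  have h3 := Ideal.ramificationIdx_tower (R := A) (maximalIdeal R) (maximalIdeal S)
  have h4 := Ideal.ramificationIdx_tower (R := A) q (maximalIdeal S)
  rw [h3, h1, h2] at h4
  simpa using h4

/-- If `q` is a `k`-rational point over a `k`-rational point, the residue degree is one. -/
theorem Ideal.inertiaDeg_eq_one_of_surjective {k A B : Type*} [Field k] [CommRing A] [CommRing B]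
    [Algebra A B] [Algebra k B] [Algebra k A] [IsScalarTower k A B] (q : Ideal B) [q.IsMaximal]
    (p : Ideal A) [p.IsMaximal] [q.LiesOver p]
    (h : Function.Surjective (algebraMap k (B ⧸ q))) : q.inertiaDeg A = 1 := by
  rw [Ideal.inertiaDeg_eq_of_isMaximal p q]
  have hb : Function.Bijective (algebraMap (A ⧸ p) (B ⧸ q)) := by
    refine ⟨FaithfulSMul.algebraMap_injective _ _, fun y ↦ ?_⟩
    obtain ⟨a, rfl⟩ := h y
    refine ⟨Ideal.Quotient.mk p (algebraMap k A a), ?_⟩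
    change Ideal.Quotient.mk q (algebraMap A B (algebraMap k A a)) =
      Ideal.Quotient.mk q (algebraMap k B a)
    rw [← IsScalarTower.algebraMap_apply]
  rw [← (LinearEquiv.ofBijective (Algebra.linearMap (A ⧸ p) (B ⧸ q)) hb).finrank_eq]
  exact Module.finrank_self _

end LocalAlgebra

namespace RecursiveTower

/-! ### Points and local rings of smooth curves over an algebraically closed field -/

section LocalRings

variable {K : Type u} [Field K] {Y : Scheme.{u}}

/-- The constants `K → 𝒪_{Y,x}` of a scheme over `K`. -/
def constStalk (s : Y ⟶ Spec (.of K)) (x : Y) : K →+* Y.presheaf.stalk x :=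
  ((Scheme.ΓSpecIso (.of K)).inv ≫ s.appTop ≫
    Y.presheaf.germ ⊤ x (TopologicalSpace.Opens.mem_top _)).hom

/-- The constants `K → Γ(Y, U)` of a scheme over `K`. -/
def constΓ (s : Y ⟶ Spec (.of K)) (U : Y.Opens) : K →+* Γ(Y, U) :=
  ((Scheme.ΓSpecIso (.of K)).inv ≫ s.appLE ⊤ U le_top).hom

theorem germ_constΓ (s : Y ⟶ Spec (.of K)) {U : Y.Opens} {x : Y} (hx : x ∈ U) (c : K) :
    Y.presheaf.germ U x hx (constΓ s U c) = constStalk s x c := by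
  have h : s.appLE ⊤ U le_top ≫ Y.presheaf.germ U x hx =
      s.appTop ≫ Y.presheaf.germ ⊤ x (TopologicalSpace.Opens.mem_top _) := by
    change (s.app ⊤ ≫ Y.presheaf.map _) ≫ Y.presheaf.germ U x hx = _
    rw [Category.assoc, TopCat.Presheaf.germ_res]
    rfl
  exact congr($h ((Scheme.ΓSpecIso (.of K)).inv c))

theorem specMap_constStalk (s : Y ⟶ Spec (.of K)) (x : Y) :
    Spec.map (CommRingCat.ofHom (constStalk s x)) = Y.fromSpecStalk x ≫ s := by
  apply ext_of_isAffine
  rw [Scheme.Hom.comp_appTop, Scheme.fromSpecStalk_appTop]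
  simp only [constStalk, CommRingCat.ofHom_hom]
  rw [← cancel_mono (Scheme.ΓSpecIso _).hom, Scheme.ΓSpecIso_naturality]
  simp

/-- Over an algebraically closed field, the closed points are rational. -/
theorem residue_constStalk_bijective [IsAlgClosed K] (s : Y ⟶ Spec (.of K))
    [LocallyOfFiniteType s] {x : Y} (hx : IsClosed {x}) :
    Function.Bijective ((Y.residue x).hom.comp (constStalk s x)) := by
  have h : CommRingCat.ofHom (constStalk s x) ≫ Y.residue x = (residueFieldIsoBase s x hx).inv := by
    apply Spec.map_injective
    rw [SpecMap_residueFieldIsoBase_inv, Spec.map_comp, specMap_constStalk, ← Category.assoc]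
    rfl
  have := (residueFieldIsoBase s x hx).symm.commRingCatIsoToRingEquiv.bijective
  convert this
  exact congr(($h).hom)

/-- The local rings of a smooth curve at its closed points are discrete valuation rings. -/
theorem isDiscreteValuationRing_stalk [IsAlgClosed K] [IsIntegral Y] (s : Y ⟶ Spec (.of K))
    [SmoothOfRelativeDimension 1 s] {x : Y} (hx : IsClosed {x}) :
    IsDiscreteValuationRing (Y.presheaf.stalk x) := by
  have : Smooth s := SmoothOfRelativeDimension.smooth 1 s
  have : IsLocallyNoetherian Y := LocallyOfFiniteType.isLocallyNoetherian s
  obtain ⟨U, hU, V, hV, hxV, e, hf⟩ :=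
    SmoothOfRelativeDimension.exists_isStandardSmoothOfRelativeDimension (n := 1) (f := s) x
  have hUtop : U = ⊤ := by
    rw [eq_top_iff]
    intro y _
    rw [Subsingleton.elim y (s x)]
    exact e hxV
  subst hUtop
  have hc : (constΓ s V).IsStandardSmoothOfRelativeDimension 1 :=
    RingHom.isStandardSmoothOfRelativeDimension_respectsIso.2 _
      (Scheme.ΓSpecIso (.of K)).symm.commRingCatIsoToRingEquiv hf
  algebraize [constΓ s V, (Y.presheaf.germ V x hxV).hom,
    (Y.presheaf.germ V x hxV).hom.comp (constΓ s V)]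
  have hloc := hV.isLocalization_stalk ⟨x, hxV⟩
  refine IsLocalRing.isDiscreteValuationRing_of_isStandardSmooth (k := K) (A := Γ(Y, V))
    (hV.primeIdealOf ⟨x, hxV⟩).asIdeal.primeCompl fun y ↦ ?_
  obtain ⟨a, ha⟩ := (residue_constStalk_bijective s hx).surjective y
  refine ⟨a, ?_⟩
  rw [← ha, RingHom.comp_apply, ← germ_constΓ s hxV]
  rfl

theorem coheight_eq_one_of_isClosed [IsAlgClosed K] [IsIntegral Y] (s : Y ⟶ Spec (.of K))
    [SmoothOfRelativeDimension 1 s] {x : Y} (hx : IsClosed {x}) : Order.coheight x = 1 := by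
  have := isDiscreteValuationRing_stalk s hx
  have h1 := IsDiscreteValuationRing.ringKrullDim_eq_one (Y.presheaf.stalk x)
  rw [ringKrullDim_stalk_eq_coheight] at h1
  exact_mod_cast h1

theorem not_isClosed_genericPoint [IsAlgClosed K] [IsIntegral Y] (s : Y ⟶ Spec (.of K))
    [SmoothOfRelativeDimension 1 s] : ¬ IsClosed {genericPoint Y} := fun h ↦
  have := isDiscreteValuationRing_stalk s h
  IsDiscreteValuationRing.not_isField Y.functionField (Field.toIsField _)

/-- A point `x` specialises to a closed point `z`, hence comes from one of the two primes of the
discrete valuation ring `𝒪_{Y,z}`. -/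
theorem eq_genericPoint_or_isClosed [IsAlgClosed K] [IsIntegral Y] [CompactSpace Y]
    (s : Y ⟶ Spec (.of K)) [SmoothOfRelativeDimension 1 s] (x : Y) :
    x = genericPoint Y ∨ IsClosed {x} := by
  obtain ⟨z, hz, hzc⟩ := IsClosed.exists_closed_singleton (isClosed_closure (s := {x}))
    (Set.singleton_nonempty x).closure
  have hDVR := isDiscreteValuationRing_stalk s hzc
  have hxz : x ⤳ z := specializes_iff_mem_closure.mpr hz
  obtain ⟨p, rfl⟩ : x ∈ Set.range (Y.fromSpecStalk z) := by
    rw [Scheme.range_fromSpecStalk]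
    exact hxz
  by_cases hp : p.asIdeal = ⊥
  · left
    have hgen : genericPoint Y ∈ Set.range (Y.fromSpecStalk z) := by
      rw [Scheme.range_fromSpecStalk]
      exact genericPoint_specializes z
    obtain ⟨q, hq⟩ := hgen
    have h1 : p ⤳ q := (PrimeSpectrum.le_iff_specializes p q).mp
      (show p.asIdeal ≤ q.asIdeal by rw [hp]; exact bot_le)
    rw [← hq]
    refine ((h1.map (Y.fromSpecStalk z).continuous).antisymm ?_).eq
    rw [hq]
    exact genericPoint_specializes _
  · right
    have hp' : p = IsLocalRing.closedPoint _ := PrimeSpectrum.ext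
      (IsLocalRing.eq_maximalIdeal (p.isPrime.isMaximal hp))
    have hz' : Y.fromSpecStalk z p = z := by
      rw [hp']; exact Scheme.fromSpecStalk_closedPoint
    rwa [hz']

/-- A proper closed subset of a smooth curve is finite: the generic points of its irreducible
components are closed. -/
theorem finite_of_isClosed [IsAlgClosed K] [IsIntegral Y] [CompactSpace Y]
    (s : Y ⟶ Spec (.of K)) [SmoothOfRelativeDimension 1 s] {Z : Set Y} (hZ : IsClosed Z)
    (h : genericPoint Y ∉ Z) : Z.Finite := by
  have : Smooth s := SmoothOfRelativeDimension.smooth 1 s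
  have : IsLocallyNoetherian Y := LocallyOfFiniteType.isLocallyNoetherian s
  have : IsNoetherian Y := {}
  obtain ⟨S, hS, hSc, hSi, rfl⟩ :=
    TopologicalSpace.NoetherianSpace.exists_finite_set_isClosed_irreducible hZ
  refine hS.sUnion fun t ht ↦ ?_
  obtain ⟨x, hx⟩ := QuasiSober.sober (hSi t ht) (hSc t ht)
  rcases eq_genericPoint_or_isClosed s x with rfl | hxc
  · exact absurd ⟨t, ht, hx.mem⟩ h
  · rw [← hx.def, hxc.closure_eq]
    exact Set.finite_singleton x

end LocalRings

/-! ### Finiteness of nonconstant morphisms -/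

section Morphisms

variable {K : Type u} [Field K] {Y Z : Scheme.{u}}

theorem isProper_of_comp_eq (sY : Y ⟶ Spec (.of K)) (sZ : Z ⟶ Spec (.of K)) [IsProper sY]
    [IsProper sZ] {f : Y ⟶ Z} (w : f ≫ sZ = sY) : IsProper f := by
  have : IsProper (f ≫ sZ) := w ▸ inferInstance
  exact .of_comp f sZ

theorem compactSpace_of_isProper (sY : Y ⟶ Spec (.of K)) [IsProper sY] : CompactSpace Y :=
  (quasiCompact_iff_compactSpace sY).mp inferInstance

theorem isClosed_map (sY : Y ⟶ Spec (.of K)) (sZ : Z ⟶ Spec (.of K)) [IsProper sY] [IsProper sZ]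
    {f : Y ⟶ Z} (w : f ≫ sZ = sY) {x : Y} (hx : IsClosed {x}) : IsClosed {f x} := by
  have := isProper_of_comp_eq sY sZ w
  simpa using f.isClosedMap _ hx

theorem isClosed_of_isClosed_map [IsAlgClosed K] [IsIntegral Y] [IsIntegral Z]
    (sY : Y ⟶ Spec (.of K)) (sZ : Z ⟶ Spec (.of K)) [SmoothOfRelativeDimension 1 sY]
    [SmoothOfRelativeDimension 1 sZ] [IsProper sY] {f : Y ⟶ Z} [IsDominant f] {x : Y}
    (hx : IsClosed {f x}) : IsClosed {x} := by
  have := compactSpace_of_isProper sY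
  refine (eq_genericPoint_or_isClosed sY x).resolve_left fun h ↦ not_isClosed_genericPoint sZ ?_
  rwa [← map_genericPoint f, ← h]

/-- A nonconstant morphism of proper smooth curves is proper with finite fibres, hence finite. -/
theorem isFinite_of_isDominant [IsAlgClosed K] [IsIntegral Y] [IsIntegral Z]
    (sY : Y ⟶ Spec (.of K)) (sZ : Z ⟶ Spec (.of K)) [SmoothOfRelativeDimension 1 sY]
    [SmoothOfRelativeDimension 1 sZ] [IsProper sY] [IsProper sZ] {f : Y ⟶ Z}
    (w : f ≫ sZ = sY) [IsDominant f] : IsFinite f := by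
  have := isProper_of_comp_eq sY sZ w
  have := compactSpace_of_isProper sY
  have := compactSpace_of_isProper sZ
  have : LocallyQuasiFinite f := by
    refine .of_finite_preimage_singleton f fun z ↦ ?_
    rcases eq_genericPoint_or_isClosed sZ z with rfl | hz
    · refine (Set.finite_singleton (genericPoint Y)).subset fun x hx ↦ ?_
      rcases eq_genericPoint_or_isClosed sY x with rfl | hx'
      · rfl
      · refine absurd ?_ (not_isClosed_genericPoint sZ)
        rw [← show f x = genericPoint Z from hx]
        exact isClosed_map sY sZ w hx'
    · refine finite_of_isClosed sY (hz.preimage f.continuous) fun h ↦ ?_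
      refine not_isClosed_genericPoint sZ ?_
      rw [← map_genericPoint f, show f (genericPoint Y) = z from h]
      exact hz
  exact .of_isProper_of_locallyQuasiFinite f

end Morphisms

/-! ### Pullback of rational functions and orders of vanishing -/

section Pullback

variable {X Y Z : Scheme.{u}} [IsIntegral X] [IsIntegral Y] [IsIntegral Z]

theorem pullbackFun_algebraMap (f : X ⟶ Y) [IsDominant f] (x : X) (r : Y.presheaf.stalk (f x)) :
    pullbackFun f (algebraMap _ Y.functionField r) =
      algebraMap (X.presheaf.stalk x) X.functionField (f.stalkMap x r) := by
  have h := Scheme.Hom.stalkSpecializes_stalkMap f (genericPoint X) x (genericPoint_specializes x)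
  have h2 : Y.presheaf.stalkSpecializes (genericPoint_specializes (f x)) ≫
      Y.presheaf.stalkSpecializes (specializes_of_eq (map_genericPoint f)) =
      Y.presheaf.stalkSpecializes ((genericPoint_specializes x).map f.continuous) := by
    simp
  change ((Y.presheaf.stalkSpecializes (genericPoint_specializes (f x)) ≫
    Y.presheaf.stalkSpecializes (specializes_of_eq (map_genericPoint f))) ≫
    f.stalkMap (genericPoint X)) r = _
  rw [h2, h]
  rfl

theorem genericPoint_mem (U : X.Opens) [h : Nonempty U] : genericPoint X ∈ U :=
  ((genericPoint_spec X).mem_open_set_iff U.isOpen).mpr (by simpa using h)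

theorem pullbackFun_germ (f : X ⟶ Y) [IsDominant f] (V : Y.Opens) (hV : genericPoint Y ∈ V)
    (U : X.Opens) (hU : genericPoint X ∈ U) (e : U ≤ f ⁻¹ᵁ V) (a : Γ(Y, V)) :
    pullbackFun f (Y.presheaf.germ V _ hV a) = X.presheaf.germ U _ hU (f.appLE V U e a) := by
  have h0 : f (genericPoint X) ∈ V := e hU
  have h1 : Y.presheaf.germ V _ hV ≫
      Y.presheaf.stalkSpecializes (specializes_of_eq (map_genericPoint f)) =
      Y.presheaf.germ V _ h0 := by
    rw [TopCat.Presheaf.germ_stalkSpecializes]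
  change ((Y.presheaf.germ V _ hV ≫
      Y.presheaf.stalkSpecializes (specializes_of_eq (map_genericPoint f))) ≫
      f.stalkMap (genericPoint X)) a = _
  rw [h1, Scheme.Hom.germ_stalkMap, Scheme.Hom.appLE]
  change _ = ((f.app V ≫ X.presheaf.map _) ≫ X.presheaf.germ U _ hU) a
  rw [Category.assoc, TopCat.Presheaf.germ_res]

theorem pullbackFun_comp (f : X ⟶ Y) (g : Y ⟶ Z) (h : X ⟶ Z) [IsDominant f] [IsDominant g]
    [IsDominant h] (w : f ≫ g = h) (φ : Z.functionField) :
    pullbackFun h φ = pullbackFun f (pullbackFun g φ) := by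
  subst w
  obtain ⟨V, hV, a, rfl⟩ := Z.presheaf.exists_germ_eq φ
  have h1 : genericPoint Y ∈ g ⁻¹ᵁ V := by
    change g _ ∈ V; rwa [map_genericPoint]
  have h2 : genericPoint X ∈ f ⁻¹ᵁ g ⁻¹ᵁ V := by
    change f _ ∈ g ⁻¹ᵁ V; rwa [map_genericPoint]
  rw [pullbackFun_germ g V hV _ h1 le_rfl, pullbackFun_germ f _ h1 _ h2 le_rfl,
    pullbackFun_germ (f ≫ g) V hV _ h2 le_rfl]
  simp [Scheme.Hom.appLE]

theorem pullbackFun_constStalk {K : Type u} [Field K] (f : X ⟶ Y) [IsDominant f]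
    (sX : X ⟶ Spec (.of K)) (sY : Y ⟶ Spec (.of K)) (w : f ≫ sY = sX) (c : K) :
    pullbackFun f (constStalk sY (genericPoint Y) c) = constStalk sX (genericPoint X) c := by
  subst w
  refine (pullbackFun_germ f ⊤ (TopologicalSpace.Opens.mem_top _) ⊤
    (TopologicalSpace.Opens.mem_top _) le_top
    (sY.appTop ((Scheme.ΓSpecIso (.of K)).inv c))).trans ?_
  simp [constStalk, Scheme.Hom.appLE]
  rfl

end Pullback

/-- The ramification index of a morphism of schemes at a point. -/
def ramIdxAt {X Y : Scheme.{u}} (f : X ⟶ Y) (x : X) : ℕ :=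
  letI := (f.stalkMap x).hom.toAlgebra
  (IsLocalRing.maximalIdeal (X.presheaf.stalk x)).ramificationIdx (Y.presheaf.stalk (f x))

theorem stalkMap_injective {X Y : Scheme.{u}} [IsIntegral X] [IsIntegral Y] (f : X ⟶ Y)
    [IsDominant f] (x : X) : Function.Injective (f.stalkMap x) := by
  intro a b hab
  apply IsFractionRing.injective (Y.presheaf.stalk (f x)) Y.functionField
  apply (pullbackFun f).injective
  rw [pullbackFun_algebraMap, pullbackFun_algebraMap, hab]

section Orders

variable {K : Type u} [Field K] [IsAlgClosed K] {Y Z : Scheme.{u}} [IsIntegral Y] [IsIntegral Z]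
  (sY : Y ⟶ Spec (.of K)) (sZ : Z ⟶ Spec (.of K)) [SmoothOfRelativeDimension 1 sY]
  [SmoothOfRelativeDimension 1 sZ] [IsProper sY] [IsProper sZ] {f : Y ⟶ Z}

/-- The ramification index is positive: otherwise the maximal ideal downstairs would generate the
unit ideal upstairs, although the homomorphism of local rings is local. -/
theorem ramIdxAt_pos (w : f ≫ sZ = sY) [IsDominant f] {x : Y} (hx : IsClosed {x}) :
    0 < ramIdxAt f x := by
  have := isDiscreteValuationRing_stalk sY hx
  have := isDiscreteValuationRing_stalk sZ (isClosed_map sY sZ w hx)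
  algebraize [(f.stalkMap x).hom]
  have hloc : IsLocalHom (algebraMap (Z.presheaf.stalk (f x)) (Y.presheaf.stalk x)) :=
    inferInstanceAs (IsLocalHom (f.stalkMap x).hom)
  have : FaithfulSMul (Z.presheaf.stalk (f x)) (Y.presheaf.stalk x) :=
    (faithfulSMul_iff_algebraMap_injective _ _).mpr (stalkMap_injective f x)
  have key := IsLocalRing.map_maximalIdeal_eq_pow_ramificationIdx
    (R := Z.presheaf.stalk (f x)) (S := Y.presheaf.stalk x)
  refine Nat.pos_of_ne_zero fun h0 ↦ ?_
  have h1 : (IsLocalRing.maximalIdeal (Y.presheaf.stalk x)).ramificationIdx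
    (Z.presheaf.stalk (f x)) = 0 := h0
  have h2 := ((IsLocalRing.local_hom_TFAE
    (algebraMap (Z.presheaf.stalk (f x)) (Y.presheaf.stalk x))).out 0 2).mp hloc
  rw [key, h1, pow_zero, Ideal.one_eq_top] at h2
  exact Ideal.IsPrime.ne_top' (top_le_iff.mp h2)

/-- `ord_x (h ∘ f) = e_f(x) ord_{f(x)} h`. -/
theorem ord_pullbackFun [IsLocallyNoetherian Y] [IsLocallyNoetherian Z] (w : f ≫ sZ = sY)
    [IsDominant f] {x : Y} (hx : IsClosed {x}) {h : Z.functionField} (hh : h ≠ 0) :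
    Scheme.ord (pullbackFun f h) x = ramIdxAt f x * Scheme.ord h (f x) := by
  have hfx := isClosed_map sY sZ w hx
  have hx1 := coheight_eq_one_of_isClosed sY hx
  have hfx1 := coheight_eq_one_of_isClosed sZ hfx
  have := isDiscreteValuationRing_stalk sY hx
  have := isDiscreteValuationRing_stalk sZ hfx
  algebraize [(f.stalkMap x).hom]
  have hloc : IsLocalHom (algebraMap (Z.presheaf.stalk (f x)) (Y.presheaf.stalk x)) :=
    inferInstanceAs (IsLocalHom (f.stalkMap x).hom)
  have : FaithfulSMul (Z.presheaf.stalk (f x)) (Y.presheaf.stalk x) :=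
    (faithfulSMul_iff_algebraMap_injective _ _).mpr (stalkMap_injective f x)
  have key := Ring.ordFrac_algebraMap_eq_pow (R := Z.presheaf.stalk (f x))
    (S := Y.presheaf.stalk x) (pullbackFun f) (pullbackFun_algebraMap f x) hh
  have hh' : pullbackFun f h ≠ 0 := by simpa using hh
  rw [Scheme.ord_eq_iff hx1 hh']
  have h1 := (Scheme.ord_eq_iff hfx1 hh).mp rfl
  change Scheme.ordHom x hx1 _ = Scheme.ordHom (f x) hfx1 h ^ _ at key
  rw [key, h1, ← nsmul_eq_mul, ofAdd_nsmul, WithZero.coe_pow]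
  rfl

end Orders

/-! ### The fundamental identity -/

section Sections

variable {K : Type u} [Field K] {Y Z : Scheme.{u}}

theorem appLE_constΓ (sY : Y ⟶ Spec (.of K)) (sZ : Z ⟶ Spec (.of K)) {f : Y ⟶ Z}
    (w : f ≫ sZ = sY) (V : Z.Opens) (U : Y.Opens) (e : U ≤ f ⁻¹ᵁ V) (c : K) :
    f.appLE V U e (constΓ sZ V c) = constΓ sY U c := by
  subst w
  have := Scheme.Hom.appLE_comp_appLE f sZ ⊤ V U le_top e
  exact congr($this ((Scheme.ΓSpecIso (.of K)).inv c))

theorem primeIdealOf_mem_iff {U : Y.Opens} (hU : IsAffineOpen U) {x : Y} (hx : x ∈ U)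
    (b : Γ(Y, U)) :
    b ∈ (hU.primeIdealOf ⟨x, hx⟩).asIdeal ↔
      Y.presheaf.germ U x hx b ∈ IsLocalRing.maximalIdeal (Y.presheaf.stalk x) := by
  rw [hU.primeIdealOf_eq_map_closedPoint]
  rfl

theorem exists_primeIdealOf_eq {U : Y.Opens} (hU : IsAffineOpen U) (q : PrimeSpectrum Γ(Y, U)) :
    ∃ x : U, hU.primeIdealOf x = q :=
  hU.isoSpec.hom.surjective q

/-- The residue field of a closed point, computed in an affine chart, consists of constants. -/
theorem constΓ_quotient_surjective [IsAlgClosed K] (s : Y ⟶ Spec (.of K))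
    [LocallyOfFiniteType s] {U : Y.Opens} (hU : IsAffineOpen U) {x : Y} (hx : x ∈ U)
    (hxc : IsClosed {x}) :
    Function.Surjective
      ((Ideal.Quotient.mk (hU.primeIdealOf ⟨x, hx⟩).asIdeal).comp (constΓ s U)) := by
  intro b
  obtain ⟨b, rfl⟩ := Ideal.Quotient.mk_surjective b
  obtain ⟨c, hc⟩ := (residue_constStalk_bijective s hxc).surjective
    (Y.residue x (Y.presheaf.germ U x hx b))
  refine ⟨c, ?_⟩
  rw [RingHom.comp_apply, Ideal.Quotient.eq, primeIdealOf_mem_iff, map_sub, germ_constΓ,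
    ← IsLocalRing.residue_eq_zero_iff, map_sub, sub_eq_zero]
  exact hc

end Sections

theorem isDedekindDomain_of_isAffineOpen {K : Type u} [Field K] [IsAlgClosed K] {Y : Scheme.{u}}
    [IsIntegral Y] (s : Y ⟶ Spec (.of K)) [SmoothOfRelativeDimension 1 s] [IsProper s]
    {U : Y.Opens} (hU : IsAffineOpen U) [Nonempty U] : IsDedekindDomain Γ(Y, U) := by
  have : Smooth s := SmoothOfRelativeDimension.smooth 1 s
  have : IsLocallyNoetherian Y := LocallyOfFiniteType.isLocallyNoetherian s
  have := compactSpace_of_isProper s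
  have : IsNoetherianRing Γ(Y, U) := IsLocallyNoetherian.component_noetherian ⟨U, hU⟩
  have : IsDedekindDomainDvr Γ(Y, U) := by
    refine { is_dvr_at_nonzero_prime := fun P hP hPp ↦ ?_ }
    obtain ⟨x, hx⟩ := exists_primeIdealOf_eq hU ⟨P, hPp⟩
    obtain rfl : (hU.primeIdealOf x).asIdeal = P := congr(($hx).asIdeal)
    rcases eq_genericPoint_or_isClosed s x.1 with h | h
    · refine absurd ?_ hP
      rw [eq_bot_iff]
      obtain ⟨x, hxU⟩ := x
      obtain rfl : x = genericPoint Y := h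
      intro b hb
      rw [primeIdealOf_mem_iff] at hb
      have h0 : Y.presheaf.germ U (genericPoint Y) hxU b = 0 := by
        by_contra hne
        exact hb (IsUnit.mk0 (G₀ := Y.functionField) _ hne)
      rw [Ideal.mem_bot]
      exact germ_injective_of_isIntegral _ _ hxU (h0.trans (map_zero _).symm)
    · have := isDiscreteValuationRing_stalk s h
      have := hU.isLocalization_stalk x
      exact IsDiscreteValuationRing.RingEquivClass.isDiscreteValuationRing
        (IsLocalization.algEquiv (hU.primeIdealOf x).asIdeal.primeCompl
          (Y.presheaf.stalk x.1) (Localization.AtPrime (hU.primeIdealOf x).asIdeal))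
  infer_instance

/-- The ramification index at a point is the ramification index of the corresponding prime ideal, in
any affine charts. -/
theorem ramIdxAt_eq {K : Type u} [Field K] [IsAlgClosed K] {Y Z : Scheme.{u}}
    [IsIntegral Y] [IsIntegral Z] (sY : Y ⟶ Spec (.of K)) (sZ : Z ⟶ Spec (.of K))
    [SmoothOfRelativeDimension 1 sY] [SmoothOfRelativeDimension 1 sZ] [IsProper sY] [IsProper sZ]
    {f : Y ⟶ Z} (w : f ≫ sZ = sY) [IsDominant f] {V : Z.Opens} (hV : IsAffineOpen V)
    {U : Y.Opens} (hU : IsAffineOpen U) (e : U ≤ f ⁻¹ᵁ V) {x : Y} (hx : x ∈ U)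
    (hxc : IsClosed {x}) :
    letI := (f.appLE V U e).hom.toAlgebra
    ramIdxAt f x = (hU.primeIdealOf ⟨x, hx⟩).asIdeal.ramificationIdx Γ(Z, V) := by
  have hxV : f x ∈ V := e hx
  algebraize [(f.appLE V U e).hom, (f.stalkMap x).hom, (Y.presheaf.germ U x hx).hom,
    (Z.presheaf.germ V (f x) hxV).hom,
    (f.stalkMap x).hom.comp (Z.presheaf.germ V (f x) hxV).hom]
  have : IsLocalization.AtPrime (Y.presheaf.stalk x) (hU.primeIdealOf ⟨x, hx⟩).asIdeal :=
    hU.isLocalization_stalk ⟨x, hx⟩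
  have : IsLocalization.AtPrime (Z.presheaf.stalk (f x)) (hV.primeIdealOf ⟨f x, hxV⟩).asIdeal :=
    hV.isLocalization_stalk ⟨f x, hxV⟩
  have : IsScalarTower Γ(Z, V) Γ(Y, U) (Y.presheaf.stalk x) := .of_algebraMap_eq fun a ↦ by
    have h : Z.presheaf.germ V (f x) hxV ≫ f.stalkMap x =
        f.appLE V U e ≫ Y.presheaf.germ U x hx := by
      rw [Scheme.Hom.germ_stalkMap]
      change _ = (f.app V ≫ Y.presheaf.map _) ≫ Y.presheaf.germ U x hx
      rw [Category.assoc, TopCat.Presheaf.germ_res]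
    exact congr($h a)
  have : IsLocalHom (algebraMap (Z.presheaf.stalk (f x)) (Y.presheaf.stalk x)) :=
    inferInstanceAs (IsLocalHom (f.stalkMap x).hom)
  have : FaithfulSMul (Z.presheaf.stalk (f x)) (Y.presheaf.stalk x) :=
    (faithfulSMul_iff_algebraMap_injective _ _).mpr (stalkMap_injective f x)
  have := isDiscreteValuationRing_stalk sZ (isClosed_map sY sZ w hxc)
  exact Ideal.ramificationIdx_eq_of_isLocalization (hV.primeIdealOf ⟨f x, hxV⟩).asIdeal
    (hU.primeIdealOf ⟨x, hx⟩).asIdeal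

/-- The fundamental identity `∑ e = [K(Y) : K(Z)]` over an algebraically closed field, where all the
residue degrees are one. Above an affine open set the morphism is a finite extension of Dedekind
domains, and the identity is `∑ e f = n` for the primes above the prime of `z`. -/
theorem finite_fiber_and_sum_ramIdxAt {K : Type u} [Field K] [IsAlgClosed K] {Y Z : Scheme.{u}}
    [IsIntegral Y] [IsIntegral Z] (sY : Y ⟶ Spec (.of K)) (sZ : Z ⟶ Spec (.of K))
    [SmoothOfRelativeDimension 1 sY] [SmoothOfRelativeDimension 1 sZ] [IsProper sY] [IsProper sZ]
    {f : Y ⟶ Z} (w : f ≫ sZ = sY) [IsDominant f] {z : Z} (hz : IsClosed {z}) :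
    Finite (f ⁻¹' {z}) ∧ ∑ᶠ x : f ⁻¹' {z}, ramIdxAt f x =
      @Module.finrank Z.functionField Y.functionField _ _ (pullbackFun f).toAlgebra.toModule := by
  have : Smooth sZ := SmoothOfRelativeDimension.smooth 1 sZ
  have : Smooth sY := SmoothOfRelativeDimension.smooth 1 sY
  have := isFinite_of_isDominant sY sZ w
  have := isProper_of_comp_eq sY sZ w
  obtain ⟨_, ⟨V, hV, rfl⟩, hzV, -⟩ :=
    Z.isBasis_affineOpens.exists_subset_of_mem_open (Set.mem_univ z) isOpen_univ
  have hzV : z ∈ V := hzV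
  have hV : IsAffineOpen V := hV
  set U : Y.Opens := f ⁻¹ᵁ V with hUdef
  have hU : IsAffineOpen U := hV.preimage f
  obtain ⟨y₀, hy₀⟩ := f.surjective z
  have : Nonempty V := ⟨⟨z, hzV⟩⟩
  have : Nonempty U := ⟨⟨y₀, by rw [hUdef]; change f y₀ ∈ V; rwa [hy₀]⟩⟩
  have hgV := genericPoint_mem V
  have hgU := genericPoint_mem U
  have hA := isDedekindDomain_of_isAffineOpen sZ hV
  have := functionField_isFractionRing_of_isAffineOpen Y U hU
  have := functionField_isFractionRing_of_isAffineOpen Z V hV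
  have hfin : (f.appLE V U le_rfl).hom.Finite := by
    rw [← Scheme.Hom.app_eq_appLE]
    exact f.finite_app V hV
  algebraize [(f.appLE V U le_rfl).hom, constΓ sZ V, constΓ sY U, pullbackFun f,
    (pullbackFun f).comp (algebraMap Γ(Z, V) Z.functionField)]
  have : IsScalarTower K Γ(Z, V) Γ(Y, U) :=
    .of_algebraMap_eq fun c ↦ (appLE_constΓ sY sZ w V U le_rfl c).symm
  have : IsScalarTower Γ(Z, V) Γ(Y, U) Y.functionField :=
    .of_algebraMap_eq fun a ↦ pullbackFun_germ f V hgV U hgU le_rfl a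
  have hmem (x : f ⁻¹' {z}) : x.1 ∈ U := by
    change f x.1 ∈ V
    rwa [show f x.1 = z from x.2]
  have : FaithfulSMul Γ(Z, V) Γ(Y, U) := by
    rw [faithfulSMul_iff_algebraMap_injective]
    intro a b hab
    apply Z.germToFunctionField_injective V
    apply (pullbackFun f).injective
    exact (pullbackFun_germ f V hgV U hgU le_rfl a).trans
      ((congrArg (Y.germToFunctionField U) hab).trans
        (pullbackFun_germ f V hgV U hgU le_rfl b).symm)
  set p := (hV.primeIdealOf ⟨z, hzV⟩).asIdeal with hp
  have hpm : p.IsMaximal := hV.primeIdealOf_isMaximal_of_isClosed ⟨z, hzV⟩ hz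
  have hlies (x : f ⁻¹' {z}) : (hU.primeIdealOf ⟨x.1, hmem x⟩).asIdeal.LiesOver p := by
    obtain ⟨x, hx⟩ := x
    have hx' : f x = z := hx
    subst hx'
    exact ⟨congr(($(IsAffineOpen.comap_primeIdealOf_appLE V hV U hU le_rfl
      (hmem ⟨x, hx⟩))).asIdeal).symm⟩
  -- the points of the fibre are the primes above `p`
  let e₀ (x : f ⁻¹' {z}) : p.primesOver Γ(Y, U) :=
    ⟨(hU.primeIdealOf ⟨x.1, hmem x⟩).asIdeal, (hU.primeIdealOf ⟨x.1, hmem x⟩).isPrime, hlies x⟩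
  have he₀ : Function.Bijective e₀ := by
    constructor
    · intro x y hxy
      have h1 : hU.primeIdealOf ⟨x.1, hmem x⟩ = hU.primeIdealOf ⟨y.1, hmem y⟩ :=
        PrimeSpectrum.ext congr(($hxy).1)
      have h2 := hU.fromSpec_primeIdealOf ⟨x.1, hmem x⟩
      rw [h1, hU.fromSpec_primeIdealOf] at h2
      exact Subtype.ext h2.symm
    · rintro ⟨q, hqp, hq⟩
      obtain ⟨⟨x, hxU⟩, hx⟩ := exists_primeIdealOf_eq hU ⟨q, hqp⟩
      have h1 := IsAffineOpen.comap_primeIdealOf_appLE V hV U hU le_rfl hxU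
      have h2 : hV.primeIdealOf ⟨f x, hxU⟩ = hV.primeIdealOf ⟨z, hzV⟩ := by
        rw [← h1, hx]
        exact PrimeSpectrum.ext hq.over.symm
      have h3 := hV.fromSpec_primeIdealOf ⟨f x, hxU⟩
      rw [h2, hV.fromSpec_primeIdealOf] at h3
      exact ⟨⟨x, h3.symm⟩, Subtype.ext congr(($hx).asIdeal)⟩
  let e := Equiv.ofBijective e₀ he₀
  have : Finite (p.primesOver Γ(Y, U)) := Algebra.QuasiFinite.finite_primesOver p
  have : Finite (f ⁻¹' {z}) := .of_equiv _ e.symm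
  refine ⟨this, ?_⟩
  have := Fintype.ofFinite (f ⁻¹' {z})
  have := Fintype.ofFinite (p.primesOver Γ(Y, U))
  rw [finsum_eq_sum_of_fintype,
    IsFractionRing.finrank_eq Γ(Z, V) Z.functionField Γ(Y, U) Y.functionField,
    ← Ideal.sum_ramification_inertia_eq_finrank p, ← e.sum_comp]
  refine Finset.sum_congr rfl fun x _ ↦ ?_
  have hxc : IsClosed {x.1} := isClosed_of_isClosed_map sY sZ (by
    rwa [show f x.1 = z from x.2])
  have hxm : (hU.primeIdealOf ⟨x.1, hmem x⟩).asIdeal.IsMaximal :=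
    hU.primeIdealOf_isMaximal_of_isClosed ⟨x.1, hmem x⟩ hxc
  have := hlies x
  change _ = (hU.primeIdealOf ⟨x.1, hmem x⟩).asIdeal.ramificationIdx Γ(Z, V) *
    (hU.primeIdealOf ⟨x.1, hmem x⟩).asIdeal.inertiaDeg Γ(Z, V)
  rw [Ideal.inertiaDeg_eq_one_of_surjective (k := K) _ p
    (constΓ_quotient_surjective sY hU (hmem x) hxc), mul_one]
  exact ramIdxAt_eq sY sZ w hV hU le_rfl (hmem x) hxc

/-! ### Functions without zeros and poles -/

/-- A rational function that is regular at every closed point is a global section. -/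
theorem exists_germ_top_eq {Y : Scheme.{u}} [IsIntegral Y] [CompactSpace Y] (h : Y.functionField)
    (H : ∀ x : Y, IsClosed {x} → h ∈ (algebraMap (Y.presheaf.stalk x) Y.functionField).range) :
    ∃ a : Γ(Y, ⊤), Y.presheaf.germ ⊤ (genericPoint Y) (TopologicalSpace.Opens.mem_top _) a = h := by
  have H' (x : {x : Y // IsClosed {x}}) : ∃ (U : Y.Opens) (hU : genericPoint Y ∈ U) (a : Γ(Y, U)),
      x.1 ∈ U ∧ Y.presheaf.germ U _ hU a = h := by
    obtain ⟨r, hr⟩ := H x.1 x.2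
    obtain ⟨U, hxU, a, rfl⟩ := Y.presheaf.exists_germ_eq r
    have : Nonempty U := ⟨⟨_, hxU⟩⟩
    refine ⟨U, genericPoint_mem U, a, hxU, ?_⟩
    rw [← hr]
    exact (Scheme.algebraMap_germ_eq_germToFunctionField Y hxU a).symm
  choose U hU a hxU ha using H'
  have hcover : (⊤ : Y.Opens) ≤ iSup U := by
    intro y _
    obtain ⟨z, hz, hzc⟩ := IsClosed.exists_closed_singleton (isClosed_closure (s := {y}))
      (Set.singleton_nonempty y).closure
    rw [TopologicalSpace.Opens.mem_iSup]
    exact ⟨⟨z, hzc⟩, (specializes_iff_mem_closure.mpr hz).mem_open (U ⟨z, hzc⟩).isOpen (hxU _)⟩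
  have hcompat : TopCat.Presheaf.IsCompatible Y.sheaf.1 U a := by
    intro i j
    apply germ_injective_of_isIntegral Y (genericPoint Y) (U := U i ⊓ U j) ⟨hU i, hU j⟩
    exact (TopCat.Presheaf.germ_res_apply Y.presheaf _ _ _ _).trans
      (((ha i).trans (ha j).symm).trans
        (TopCat.Presheaf.germ_res_apply Y.presheaf _ _ _ _).symm)
  obtain ⟨s, hs, -⟩ := Y.sheaf.existsUnique_gluing' U ⊤ (fun i ↦ homOfLE le_top) hcover a hcompat
  refine ⟨s, ?_⟩
  obtain ⟨i, hi⟩ := TopologicalSpace.Opens.mem_iSup.mp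
    (hcover (TopologicalSpace.Opens.mem_top (genericPoint Y)))
  rw [← ha i, ← hs i]
  exact (TopCat.Presheaf.germ_res_apply Y.presheaf (homOfLE le_top) _ (hU i) s).symm

theorem mem_range_algebraMap_of_ord_eq_zero {K : Type u} [Field K] [IsAlgClosed K] {Y : Scheme.{u}}
    [IsIntegral Y] [IsLocallyNoetherian Y] (s : Y ⟶ Spec (.of K)) [SmoothOfRelativeDimension 1 s]
    {x : Y} (hx : IsClosed {x}) {h : Y.functionField} (hh : h ≠ 0) (h0 : Scheme.ord h x = 0) :
    h ∈ (algebraMap (Y.presheaf.stalk x) Y.functionField).range := by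
  have := isDiscreteValuationRing_stalk s hx
  have hx1 := coheight_eq_one_of_isClosed s hx
  rw [Scheme.ord_eq_iff hx1 hh] at h0
  have h1 : h ∈ MonoidHom.mker (Ring.ordFrac (Y.presheaf.stalk x) (K := Y.functionField)) := by
    rw [MonoidHom.mem_mker]
    exact h0
  rw [Ring.mker_ordFrac_eq_isUnitSubmonoid] at h1
  obtain ⟨r, -, hr⟩ := h1
  exact ⟨r, hr⟩

/-- The global sections of a proper integral scheme are integral over the base field. -/
theorem constΓ_top_surjective {K : Type u} [Field K] [IsAlgClosed K] {Y : Scheme.{u}}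
    [IsIntegral Y] (s : Y ⟶ Spec (.of K)) [IsProper s] : Function.Surjective (constΓ s ⊤) := by
  have h1 : (constΓ s ⊤).IsIntegral := by
    have h : s.appLE ⊤ ⊤ le_top = s.appTop := s.app_eq_appLE.symm
    rw [constΓ, h]
    exact RingHom.isIntegral_respectsIso.2 (e := (Scheme.ΓSpecIso _).symm.commRingCatIsoToRingEquiv)
      _ (isIntegral_appTop_of_universallyClosed s)
  exact (IsAlgClosed.ringHom_bijective_of_isIntegral _ h1).surjective

/-- A rational function without zeros and poles on a proper smooth curve is constant. -/
theorem exists_eq_constStalk_of_ord_eq_zero {K : Type u} [Field K] [IsAlgClosed K]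
    {Y : Scheme.{u}} [IsIntegral Y] [IsLocallyNoetherian Y] (s : Y ⟶ Spec (.of K))
    [SmoothOfRelativeDimension 1 s] [IsProper s] {h : Y.functionField} (hh : h ≠ 0)
    (h0 : ∀ x : Y, IsClosed {x} → Scheme.ord h x = 0) :
    ∃ c : K, h = constStalk s (genericPoint Y) c := by
  have := compactSpace_of_isProper s
  obtain ⟨a, rfl⟩ := exists_germ_top_eq h fun x hx ↦
    mem_range_algebraMap_of_ord_eq_zero s hx hh (h0 x hx)
  obtain ⟨c, rfl⟩ := constΓ_top_surjective s a
  exact ⟨c, germ_constΓ s _ c⟩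

/-! ### Base change of the function field -/

/-- The sections of `X ×ₖ L` over the preimage of an affine open set `U` of `X` form the tensor
product of `Γ(X, U)` and `L`. -/
theorem isPushout_appLE {k L : Type u} [Field k] [Field L] [Algebra k L] {P X : Scheme.{u}}
    {pr : P ⟶ X} {sP : P ⟶ Spec (.of L)} {sX : X ⟶ Spec (.of k)}
    (h : IsPullback pr sP sX (Spec.map (CommRingCat.ofHom (algebraMap k L))))
    {U : X.Opens} (hU : IsAffineOpen U) :
    IsPushout (CommRingCat.ofHom (constΓ sX U)) (CommRingCat.ofHom (algebraMap k L))
      (pr.appLE U (pr ⁻¹ᵁ U) le_rfl) (CommRingCat.ofHom (constΓ sP (pr ⁻¹ᵁ U))) := by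
  have : IsAffine U := hU
  have h1 := isPushout_appTop_of_isPullback ((isPullback_morphismRestrict pr U).paste_vert h)
  refine h1.of_iso (Scheme.ΓSpecIso _) U.topIso (Scheme.ΓSpecIso _) (pr ⁻¹ᵁ U).topIso ?_ ?_ ?_ ?_
  · rw [constΓ, CommRingCat.ofHom_hom, Iso.hom_inv_id_assoc]
    simp only [Scheme.Hom.comp_appTop, Category.assoc, Scheme.Hom.appLE]
    congr 1
    exact (X.presheaf.map_comp _ _).symm
  · simp
  · rw [morphismRestrict_appTop]
    have h2 := pr.naturality (eqToHom U.ι_image_top.symm).op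
    simp only [Scheme.Hom.appLE]
    refine (Category.assoc _ _ _).trans ?_
    refine (congrArg (pr.app (U.ι ''ᵁ ⊤) ≫ ·) (P.presheaf.map_comp _ _).symm).trans ?_
    refine Eq.trans ?_ ((congrArg (· ≫ P.presheaf.map (𝟙 _)) h2.symm).trans (Category.assoc _ _ _))
    refine Eq.trans ?_ (Category.assoc _ _ _).symm
    exact congrArg (pr.app (U.ι ''ᵁ ⊤) ≫ ·)
      ((congrArg P.presheaf.map (Subsingleton.elim _ _)).trans (P.presheaf.map_comp _ _))
  · rw [constΓ, CommRingCat.ofHom_hom, Iso.hom_inv_id_assoc]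
    simp only [Scheme.Hom.comp_appTop, Category.assoc, Scheme.Hom.appLE]
    congr 1
    exact (P.presheaf.map_comp _ _).symm

theorem constΓ_congr {k : Type u} [Field k] {X : Scheme.{u}} {s t : X ⟶ Spec (.of k)} (h : s = t)
    (U : X.Opens) : constΓ s U = constΓ t U := by
  rw [h]

theorem constΓ_comp_specMap {k L : Type u} [Field k] [Field L] [Algebra k L] {X : Scheme.{u}}
    (s : X ⟶ Spec (.of L)) (U : X.Opens) (c : k) :
    constΓ (s ≫ Spec.map (CommRingCat.ofHom (algebraMap k L))) U c =
      constΓ s U (algebraMap k L c) := by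
  have h : (Scheme.ΓSpecIso (.of k)).inv ≫
      (s ≫ Spec.map (CommRingCat.ofHom (algebraMap k L))).appLE ⊤ U le_top =
      CommRingCat.ofHom (algebraMap k L) ≫ (Scheme.ΓSpecIso (.of L)).inv ≫
        s.appLE ⊤ U le_top := by
    rw [Scheme.ΓSpecIso_inv_naturality_assoc]
    congr 1
  exact congr($h c)

namespace Curve

section BaseChange

variable {k : Type u} [Field k] (C : Curve k)

/-- The structure morphism of `C ×ₖ k̄`. -/
abbrev geomStr : C.geom ⟶ Spec (.of (AlgebraicClosure k)) := pullback.snd C.str (specClosure k)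

instance : SmoothOfRelativeDimension 1 C.geomStr :=
  have := smoothOfRelativeDimension_isStableUnderBaseChange 1
  MorphismProperty.of_isPullback (IsPullback.of_hasPullback C.str (specClosure k)) C.smooth

/-- The inclusion `k̄ → k̄(C)` of the constants. -/
def geomConst : AlgebraicClosure k →+* C.GeomFunField :=
  constStalk C.geomStr (genericPoint C.geom)

theorem toGeom_const (c : k) : C.toGeom (C.const c) = C.geomConst (algebraMap _ _ c) := by
  have h1 := pullbackFun_germ C.proj ⊤ (TopologicalSpace.Opens.mem_top _) ⊤
    (TopologicalSpace.Opens.mem_top _) le_top (constΓ C.str ⊤ c)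
  rw [germ_constΓ] at h1
  refine h1.trans ?_
  have h2 : C.proj.appLE ⊤ ⊤ le_top (constΓ C.str ⊤ c) =
      constΓ C.geomStr ⊤ (algebraMap _ _ c) := by
    refine (appLE_constΓ (C.proj ≫ C.str) C.str rfl ⊤ ⊤ le_top c).trans ?_
    rw [constΓ_congr pullback.condition]
    exact constΓ_comp_specMap _ _ _
  rw [h2, germ_constΓ]
  rfl

/-- `k(C)` as an algebra over `k`. -/
@[reducible] def algebraFunField : Algebra k C.FunField := C.const.toAlgebra

/-- `k̄(C)` as an algebra over `k(C)`. -/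
@[reducible] def algebraFunFieldGeom : Algebra C.FunField C.GeomFunField := C.toGeom.toAlgebra

/-- `k̄(C)` as an algebra over `k̄`. -/
@[reducible] def algebraGeom : Algebra (AlgebraicClosure k) C.GeomFunField :=
  C.geomConst.toAlgebra

/-- `k̄(C)` as an algebra over `k`, through `k(C)`. -/
@[reducible] def algebraBaseGeom : Algebra k C.GeomFunField :=
  (C.toGeom.comp C.const).toAlgebra

attribute [local instance] algebraFunField algebraFunFieldGeom algebraGeom algebraBaseGeom

theorem isScalarTower_left : IsScalarTower k C.FunField C.GeomFunField :=
  .of_algebraMap_eq fun _ ↦ rfl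

theorem isScalarTower_right : IsScalarTower k (AlgebraicClosure k) C.GeomFunField :=
  .of_algebraMap_eq fun c ↦ C.toGeom_const c

attribute [local instance] isScalarTower_left isScalarTower_right

/-- `k̄(C) = k(C) ⊗ k̄`. On an affine open set the sections over `k̄` are the tensor product, and
they are integral over the sections over `k`, so inverting the nonzero elements of the latter
already yields a field. -/
theorem isPushout_funField :
    Algebra.IsPushout k (AlgebraicClosure k) C.FunField C.GeomFunField := by
  obtain ⟨_, ⟨U, hU, rfl⟩, hxU, -⟩ :=
    C.X.isBasis_affineOpens.exists_subset_of_mem_open (Set.mem_univ (genericPoint C.X)) isOpen_univ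
  have hU : IsAffineOpen U := hU
  have hxU : genericPoint C.X ∈ U := hxU
  set W : C.geom.Opens := C.proj ⁻¹ᵁ U
  have : IsAffineHom (specClosure k) := inferInstance
  have : IsAffineHom C.proj :=
    MorphismProperty.of_isPullback (IsPullback.of_hasPullback C.str (specClosure k)).flip this
  have hWa : IsAffineOpen W := hU.preimage C.proj
  have : Nonempty U := ⟨⟨_, hxU⟩⟩
  have hxW : genericPoint C.geom ∈ W := by
    change C.proj _ ∈ U
    rwa [map_genericPoint]
  have : Nonempty W := ⟨⟨_, hxW⟩⟩
  have := functionField_isFractionRing_of_isAffineOpen C.X U hU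
  have := functionField_isFractionRing_of_isAffineOpen C.geom W hWa
  have key := isPushout_appLE (IsPullback.of_hasPullback C.str (specClosure k)) hU
  algebraize [constΓ C.str U, (C.proj.appLE U W le_rfl).hom,
    constΓ C.geomStr W,
    (C.proj.appLE U W le_rfl).hom.comp (constΓ C.str U),
    C.toGeom.comp (algebraMap Γ(C.X, U) C.FunField)]
  have : IsScalarTower k (AlgebraicClosure k) Γ(C.geom, W) :=
    .of_algebraMap_eq fun c ↦ congr(($key.w).hom c)
  have h1 : Algebra.IsPushout k (AlgebraicClosure k) Γ(C.X, U) Γ(C.geom, W) :=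
    CommRingCat.isPushout_iff_isPushout.mp key.flip
  have : IsScalarTower Γ(C.X, U) Γ(C.geom, W) C.GeomFunField :=
    .of_algebraMap_eq fun a ↦ pullbackFun_germ C.proj U hxU W hxW le_rfl a
  have : IsScalarTower k Γ(C.X, U) C.FunField :=
    .of_algebraMap_eq fun c ↦ (germ_constΓ C.str hxU c).symm
  have : IsScalarTower (AlgebraicClosure k) Γ(C.geom, W) C.GeomFunField :=
    .of_algebraMap_eq fun c ↦ (germ_constΓ _ hxW c).symm
  have : Algebra.IsIntegral Γ(C.X, U) Γ(C.geom, W) :=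
    Algebra.IsPushout.isIntegral (R := k) (S := AlgebraicClosure k) (A := Γ(C.X, U)) _
  have : FaithfulSMul Γ(C.X, U) Γ(C.geom, W) := by
    rw [faithfulSMul_iff_algebraMap_injective]
    intro a b hab
    apply C.X.germToFunctionField_injective U
    apply C.toGeom.injective
    exact (pullbackFun_germ C.proj U hxU W hxW le_rfl a).trans
      ((congrArg (C.geom.germToFunctionField W) hab).trans
        (pullbackFun_germ C.proj U hxU W hxW le_rfl b).symm)
  have h2 : Algebra.IsPushout Γ(C.X, U) C.FunField Γ(C.geom, W) C.GeomFunField := inferInstance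
  have h1' := h1.symm
  have : IsScalarTower k Γ(C.geom, W) C.GeomFunField :=
    .of_algebraMap_eq fun c ↦ by
      rw [IsScalarTower.algebraMap_apply k C.FunField, IsScalarTower.algebraMap_apply k Γ(C.X, U),
        IsScalarTower.algebraMap_apply k Γ(C.X, U) Γ(C.geom, W),
        ← IsScalarTower.algebraMap_apply Γ(C.X, U) Γ(C.geom, W),
        ← IsScalarTower.algebraMap_apply Γ(C.X, U) C.FunField]
  exact ((Algebra.IsPushout.comp_iff k Γ(C.X, U) (AlgebraicClosure k) Γ(C.geom, W)).mpr h2).symm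

/-- A function of `k(C)` that is constant in `k̄(C)` is a constant of `k`. -/
theorem exists_eq_const_of_toGeom_eq {φ : C.FunField} {c : AlgebraicClosure k}
    (h : C.toGeom φ = C.geomConst c) : ∃ c' : k, φ = C.const c' := by
  -- base change to `k̄` a `k`-linear retraction of `k → k(C)`
  obtain ⟨l, hl⟩ := (Algebra.linearMap k C.FunField).exists_leftInverse_of_injective
    (LinearMap.ker_eq_bot.mpr (algebraMap k C.FunField).injective)
  have hl1 : l 1 = 1 := by simpa using congr($hl 1)
  have hb := C.isPushout_funField.out
  let L : C.GeomFunField →ₗ[AlgebraicClosure k] AlgebraicClosure k :=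
    hb.lift ((Algebra.linearMap k (AlgebraicClosure k)) ∘ₗ l)
  have hL (ψ : C.FunField) : L (C.toGeom ψ) = algebraMap k _ (l ψ) :=
    hb.lift_eq ((Algebra.linearMap k (AlgebraicClosure k)) ∘ₗ l) ψ
  have hL1 : L 1 = 1 := by
    rw [← map_one C.toGeom, hL, hl1, map_one]
  have hc : c = algebraMap k _ (l φ) := by
    rw [← hL, h, show C.geomConst c = c • (1 : C.GeomFunField) from
      (mul_one _).symm.trans (Algebra.smul_def c (1 : C.GeomFunField)).symm, map_smul, hL1,
      smul_eq_mul, mul_one]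
  exact ⟨l φ, C.toGeom.injective (by rw [h, hc, toGeom_const])⟩

namespace Map

variable {C} {D : Curve k} (f : C.Map D)

theorem geom_snd : f.geom ≫ D.geomStr = C.geomStr := pullback.lift_snd _ _ _

theorem geom_proj : f.geom ≫ D.proj = C.proj ≫ f.hom := pullback.lift_fst _ _ _

theorem isPullback_geom : IsPullback f.geom C.proj D.proj f.hom := by
  refine .of_right (t := (IsPullback.of_hasPullback D.str (specClosure k)).flip) ?_ f.geom_proj
  rw [geom_snd, f.w]
  exact (IsPullback.of_hasPullback C.str (specClosure k)).flip

instance : IsDominant f.geom := by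
  have : IsProper f.hom := isProper_of_comp_eq C.str D.str f.w
  have : Surjective f.geom := MorphismProperty.of_isPullback f.isPullback_geom.flip inferInstance
  infer_instance

theorem toGeom_comap (φ : D.FunField) : C.toGeom (f.comap φ) = pullbackFun f.geom (D.toGeom φ) := by
  have : IsDominant (C.proj ≫ f.hom) := inferInstance
  exact (pullbackFun_comp C.proj f.hom _ rfl φ).symm.trans
    (pullbackFun_comp f.geom D.proj _ f.geom_proj φ)

/-- The degree does not change under base change to `k̄`: since `k̄(C) = k(C) ⊗ k̄` and
`k̄(D) = k(D) ⊗ k̄`, also `k̄(C) = k(C) ⊗ k̄(D)`, the latter tensor product being over `k(D)`. -/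
theorem finrank_geom :
    @Module.finrank D.GeomFunField C.GeomFunField _ _ (pullbackFun f.geom).toAlgebra.toModule =
      f.degree := by
  let _ := f.comap.toAlgebra
  let _ := (pullbackFun f.geom).toAlgebra
  let _ := (C.toGeom.comp f.comap).toAlgebra
  have : IsScalarTower D.FunField C.FunField C.GeomFunField := .of_algebraMap_eq fun _ ↦ rfl
  have : IsScalarTower D.FunField D.GeomFunField C.GeomFunField :=
    .of_algebraMap_eq fun φ ↦ f.toGeom_comap φ
  have : IsScalarTower k D.FunField C.FunField :=
    .of_algebraMap_eq fun c ↦ (pullbackFun_constStalk f.hom C.str D.str f.w c).symm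
  have : IsScalarTower (AlgebraicClosure k) D.GeomFunField C.GeomFunField :=
    .of_algebraMap_eq fun c ↦ (pullbackFun_constStalk f.geom C.geomStr D.geomStr f.geom_snd c).symm
  have : IsScalarTower k D.GeomFunField C.GeomFunField :=
    .of_algebraMap_eq fun c ↦ by
      rw [IsScalarTower.algebraMap_apply k (AlgebraicClosure k) C.GeomFunField,
        IsScalarTower.algebraMap_apply (AlgebraicClosure k) D.GeomFunField C.GeomFunField,
        ← IsScalarTower.algebraMap_apply k (AlgebraicClosure k) D.GeomFunField]
  have hC := C.isPushout_funField.symm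
  have hD := D.isPushout_funField.symm
  have h : Algebra.IsPushout D.FunField C.FunField D.GeomFunField C.GeomFunField :=
    (Algebra.IsPushout.comp_iff k D.FunField (AlgebraicClosure k) D.GeomFunField).mp hC
  have h2 := h.symm.out.equiv.finrank_eq
  rw [Module.finrank_baseChange] at h2
  exact h2.symm

end Map

end BaseChange

/-! ### Geometric points and divisors -/

section Divisors

variable {k : Type u} [Field k] {C D : Curve k}

namespace Pt

theorem toSection_geomStr (P : C.Pt) : P.toSection ≫ C.geomStr = 𝟙 _ := pullback.lift_snd _ _ _

theorem toSection_proj (P : C.Pt) : P.toSection ≫ C.proj = P.hom := pullback.lift_fst _ _ _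

theorem isClosed_toGeom (P : C.Pt) : IsClosed {P.toGeom} :=
  (pointEquivClosedPoint C.geomStr ⟨P.toSection, P.toSection_geomStr⟩).2

theorem toGeom_injective : Function.Injective (toGeom (C := C)) := by
  intro P Q h
  ext1
  rw [← P.toSection_proj, ← Q.toSection_proj,
    ext_of_apply_closedPoint_eq C.geomStr P.toSection_geomStr Q.toSection_geomStr h]

theorem exists_toGeom_eq {x : C.geom} (hx : IsClosed {x}) : ∃ P : C.Pt, P.toGeom = x := by
  have h := pointOfClosedPoint_comp C.geomStr x hx
  refine ⟨⟨pointOfClosedPoint C.geomStr x hx ≫ C.proj, ?_⟩, ?_⟩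
  · rw [Category.assoc, pullback.condition, reassoc_of% h]
  · refine Eq.trans ?_ (pointOfClosedPoint_apply C.geomStr x hx (IsLocalRing.closedPoint _))
    refine congrArg
      (fun σ : Spec (.of (AlgebraicClosure k)) ⟶ C.geom ↦
        σ (IsLocalRing.closedPoint (AlgebraicClosure k)))
      (pullback.hom_ext ?_ ?_)
    · exact toSection_proj _
    · exact (toSection_geomStr _).trans h.symm

end Pt

namespace Map

variable (f : C.Map D)

theorem geom_toGeom (P : C.Pt) : f.geom P.toGeom = (f.onPts P).toGeom := by
  have h : P.toSection ≫ f.geom = (f.onPts P).toSection := by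
    apply pullback.hom_ext
    · rw [Category.assoc, f.geom_proj, ← Category.assoc, P.toSection_proj]
      exact (f.onPts P).toSection_proj.symm
    · rw [Category.assoc]
      exact ((congrArg _ f.geom_snd).trans P.toSection_geomStr).trans
        (f.onPts P).toSection_geomStr.symm
  rw [Pt.toGeom, Pt.toGeom, ← h]
  rfl

theorem bijOn_fiber (Q : D.Pt) :
    Set.BijOn Pt.toGeom (f.onPts ⁻¹' {Q}) (f.geom ⁻¹' {Q.toGeom}) := by
  refine ⟨fun P hP ↦ ?_, Pt.toGeom_injective.injOn, fun x hx ↦ ?_⟩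
  · change f.geom P.toGeom = _
    rw [f.geom_toGeom, show f.onPts P = Q from hP]
  · have hx : f.geom x = Q.toGeom := hx
    have hcl : IsClosed {x} :=
      isClosed_of_isClosed_map C.geomStr D.geomStr (hx ▸ Q.isClosed_toGeom)
    obtain ⟨P, rfl⟩ := Pt.exists_toGeom_eq hcl
    exact ⟨P, Pt.toGeom_injective ((f.geom_toGeom P).symm.trans hx), rfl⟩

theorem finite_fiber (Q : D.Pt) : (f.onPts ⁻¹' {Q}).Finite := by
  have h := (finite_fiber_and_sum_ramIdxAt C.geomStr D.geomStr f.geom_snd Q.isClosed_toGeom).1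
  exact (f.bijOn_fiber Q).finite_iff_finite.mpr h

/-- The fundamental identity `∑ e_f(P) = deg f`, the sum being over the fibre of a point. -/
theorem finsum_ramIdx (Q : D.Pt) : ∑ᶠ P ∈ f.onPts ⁻¹' {Q}, f.ramIdx P = f.degree := by
  have h := (finite_fiber_and_sum_ramIdxAt C.geomStr D.geomStr f.geom_snd Q.isClosed_toGeom).2
  rw [f.finrank_geom] at h
  rw [← h, finsum_set_coe_eq_finsum_mem (f := fun x ↦ ramIdxAt f.geom x)]
  exact finsum_mem_eq_of_bijOn _ (f.bijOn_fiber Q) fun _ _ ↦ rfl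

theorem ramIdx_pos (P : C.Pt) : 0 < f.ramIdx P :=
  ramIdxAt_pos C.geomStr D.geomStr f.geom_snd P.isClosed_toGeom

theorem div_comap {φ : D.FunField} (hφ : φ ≠ 0) (P : C.Pt) :
    C.div (f.comap φ) P = f.ramIdx P * D.div φ (f.onPts P) := by
  rw [div, geomDiv, f.toGeom_comap,
    ord_pullbackFun C.geomStr D.geomStr f.geom_snd P.isClosed_toGeom (by simpa using hφ),
    f.geom_toGeom]
  rfl

end Map

theorem div_mul {φ ψ : C.FunField} (hφ : φ ≠ 0) (hψ : ψ ≠ 0) (P : C.Pt) :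
    C.div (φ * ψ) P = C.div φ P + C.div ψ P := by
  rw [div, map_mul]
  exact Scheme.ord_mul (by simpa using hφ) (by simpa using hψ)

theorem div_pow {φ : C.FunField} (hφ : φ ≠ 0) (n : ℕ) (P : C.Pt) :
    C.div (φ ^ n) P = n * C.div φ P := by
  induction n with
  | zero =>
    rw [pow_zero, div, map_one, geomDiv_one]
    simp
  | succ n ih =>
    rw [pow_succ, div_mul (pow_ne_zero n hφ) hφ, ih]
    push_cast
    ring

/-- A rational function over `k` without zeros and poles is a constant of `k`. -/
theorem exists_eq_const_of_div_eq_zero {φ : C.FunField} (hφ : φ ≠ 0) (h : ∀ P, C.div φ P = 0) :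
    ∃ c : k, φ = C.const c := by
  obtain ⟨c, hc⟩ := exists_eq_constStalk_of_ord_eq_zero C.geomStr (h := C.toGeom φ)
    (by simpa using hφ) fun x hx ↦ by
      obtain ⟨P, rfl⟩ := Pt.exists_toGeom_eq hx
      exact h P
  exact C.exists_eq_const_of_toGeom_eq hc

theorem div_const {c : k} (hc : c ≠ 0) (P : C.Pt) : C.div (C.const c) P = 0 := by
  rw [div, geomDiv, toGeom_const, geomConst, ← germ_constΓ _ (TopologicalSpace.Opens.mem_top _)]
  have : Nonempty (⊤ : C.geom.Opens) := ⟨⟨P.toGeom, TopologicalSpace.Opens.mem_top _⟩⟩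
  exact Scheme.ord_of_isUnit (U := ⊤) ((IsUnit.mk0 _ (by simpa using hc)).map _)
    (TopologicalSpace.Opens.mem_top _)

theorem eqUpToConst_iff {φ ψ : C.FunField} (hφ : φ ≠ 0) (hψ : ψ ≠ 0) :
    EqUpToConst φ ψ ↔ ∀ P, C.div φ P = C.div ψ P := by
  constructor
  · rintro ⟨c, hc, rfl⟩ P
    rw [div_mul (by simpa using hc) hψ, div_const hc, zero_add]
  · intro h
    have h1 : φ = φ * ψ⁻¹ * ψ := by
      field_simp
    have h2 : φ * ψ⁻¹ ≠ 0 := mul_ne_zero hφ (inv_ne_zero hψ)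
    obtain ⟨c, hc⟩ := exists_eq_const_of_div_eq_zero h2 fun P ↦ by
      have h3 := h P
      rw [h1, div_mul h2 hψ] at h3
      omega
    refine ⟨c, ?_, by rw [← hc, ← h1]⟩
    rintro rfl
    rw [map_zero] at hc
    exact h2 hc

end Divisors

/-! ### Regular sets and the equality of divisors -/

section Regularity

variable {k : Type u} [Field k] {C D : Curve k}

namespace Map

variable (f : C.Map D)

theorem onPts_surjective : Function.Surjective f.onPts := by
  intro Q
  have := isProper_of_comp_eq C.geomStr D.geomStr f.geom_snd
  obtain ⟨x, hx⟩ := f.geom.surjective Q.toGeom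
  obtain ⟨P, hP, -⟩ := (f.bijOn_fiber Q).surjOn hx
  exact ⟨P, hP⟩

theorem sum_ramIdx (Q : D.Pt) : ∑ P ∈ (f.finite_fiber Q).toFinset, f.ramIdx P = f.degree := by
  rw [← f.finsum_ramIdx Q, finsum_mem_eq_finite_toFinset_sum]

theorem encard_fiber_le (Q : D.Pt) : (f.onPts ⁻¹' {Q}).encard ≤ f.degree := by
  rw [(f.finite_fiber Q).encard_eq_coe_toFinset_card, ← f.sum_ramIdx Q, Nat.cast_le,
    Finset.card_eq_sum_ones]
  exact Finset.sum_le_sum fun P _ ↦ f.ramIdx_pos P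

/-- A fibre has `deg f` points exactly when it is unramified. -/
theorem encard_fiber_eq_iff (Q : D.Pt) :
    (f.onPts ⁻¹' {Q}).encard = f.degree ↔ ∀ P, f.onPts P = Q → f.ramIdx P = 1 := by
  rw [(f.finite_fiber Q).encard_eq_coe_toFinset_card, ← f.sum_ramIdx Q, Nat.cast_inj,
    Finset.card_eq_sum_ones, Finset.sum_eq_sum_iff_of_le fun P _ ↦ f.ramIdx_pos P]
  simp [eq_comm (a := 1)]

theorem finite_preimage (T₀ : Finset D.Pt) : (f.onPts ⁻¹' (T₀ : Set D.Pt)).Finite :=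
  T₀.finite_toSet.preimage' fun Q _ ↦ f.finite_fiber Q

open Classical in
theorem different_apply (S₀ : Finset D.Pt) (P : C.Pt) :
    f.different S₀ P = if f.onPts P ∈ S₀ then (f.ramIdx P : ℤ) - 1 else 0 := by
  rw [different, finsum_mem_eq_finite_toFinset_sum _ (f.finite_preimage S₀),
    Finsupp.finsetSum_apply]
  simp only [Finsupp.single_apply, Finset.sum_ite_eq', Set.Finite.mem_toFinset, Set.mem_preimage,
    Finset.mem_coe]

theorem ramIdx_eq_one_of_disjoint_ramLocus {T : Set D.Pt} (h : Disjoint T f.ramLocus) {P : C.Pt}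
    (hP : f.onPts P ∈ T) : f.ramIdx P = 1 := by
  have h1 : ¬1 < f.ramIdx P := fun h1 ↦ Set.disjoint_left.mp h hP ⟨P, h1, rfl⟩
  have h2 := f.ramIdx_pos P
  omega

end Map

open Classical in
theorem setDiv_apply (S : Finset C.Pt) (P : C.Pt) : setDiv S P = if P ∈ S then 1 else 0 := by
  rw [setDiv, Finsupp.finsetSum_apply]
  simp [Finsupp.single_apply]

variable (f g : C.Map D)

open Classical in
/-- If `g` is unramified above `T₀`, the divisors `f^* div(T₀)` and `g^* div(T₀)` agree exactly when
`f⁻¹(T₀)` is regular. -/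
theorem pullback_setDiv_eq_iff_isDRegular {d : ℕ} (hf : f.degree = d) (hg : g.degree = d)
    {T₀ : Finset D.Pt} (hT₀ : Disjoint (T₀ : Set D.Pt) g.ramLocus) :
    (∀ P, (f.ramIdx P : ℤ) * setDiv T₀ (f.onPts P) = g.ramIdx P * setDiv T₀ (g.onPts P)) ↔
      IsDRegular f g d (f.onPts ⁻¹' (T₀ : Set D.Pt)) := by
  have hg1 {P} (hP : g.onPts P ∈ T₀) : g.ramIdx P = 1 :=
    g.ramIdx_eq_one_of_disjoint_ramLocus hT₀ hP
  simp only [setDiv_apply]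
  constructor
  · intro h
    have hiff (P) : f.onPts P ∈ T₀ ↔ g.onPts P ∈ T₀ := by
      have h1 := f.ramIdx_pos P
      have h2 := g.ramIdx_pos P
      have h3 := h P
      by_cases hfP : f.onPts P ∈ T₀ <;> by_cases hgP : g.onPts P ∈ T₀ <;>
        simp [hfP, hgP] at h3 ⊢ <;> omega
    have hf1 {P} (hP : f.onPts P ∈ T₀) : f.ramIdx P = 1 := by
      have h3 := h P
      have hgP := (hiff P).mp hP
      simpa [hP, hgP, hg1 hgP] using h3
    refine ⟨f.finite_preimage T₀, fun P hP ↦ ⟨?_, ?_⟩⟩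
    · have hfib : {Q ∈ f.onPts ⁻¹' (T₀ : Set D.Pt) | (geometricGraph f g).Adj P Q} =
          g.onPts ⁻¹' {f.onPts P} := by
        ext Q
        refine ⟨fun hQ ↦ hQ.2.symm, fun hQ ↦ ⟨(hiff Q).mpr ?_, Eq.symm hQ⟩⟩
        rw [show g.onPts Q = f.onPts P from hQ]
        exact hP
      rw [hfib, ← hg, g.encard_fiber_eq_iff]
      exact fun Q hQ ↦ hg1 (hQ ▸ hP)
    · have hgP : g.onPts P ∈ T₀ := (hiff P).mp hP
      have hfib : {Q ∈ f.onPts ⁻¹' (T₀ : Set D.Pt) | (geometricGraph f g).Adj Q P} =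
          f.onPts ⁻¹' {g.onPts P} := by
        ext Q
        refine ⟨fun hQ ↦ hQ.2, fun hQ ↦ ⟨?_, hQ⟩⟩
        change f.onPts Q ∈ T₀
        rwa [show f.onPts Q = g.onPts P from hQ]
      rw [hfib, ← hf, f.encard_fiber_eq_iff]
      exact fun Q hQ ↦ hf1 (hQ ▸ hgP)
  · rintro ⟨-, h⟩
    -- `P` has `d` successors in `f⁻¹(T₀)`, so they fill the fibre `g⁻¹(f(P))`
    have hgf {Q} (hQ : g.onPts Q ∈ T₀) : f.onPts Q ∈ T₀ := by
      obtain ⟨P, hP⟩ := f.onPts_surjective (g.onPts Q)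
      have h1 := (h P (show f.onPts P ∈ T₀ from hP ▸ hQ)).1
      have h2 : {R ∈ f.onPts ⁻¹' (T₀ : Set D.Pt) | (geometricGraph f g).Adj P R} =
          g.onPts ⁻¹' {f.onPts P} :=
        (g.finite_fiber (f.onPts P)).eq_of_subset_of_encard_le' (fun R hR ↦ hR.2.symm)
          (by rw [h1, ← hg]; exact g.encard_fiber_le _)
      exact (h2.symm.subset (show Q ∈ g.onPts ⁻¹' {f.onPts P} from hP.symm)).1
    -- likewise the predecessors of `P` fill the fibre `f⁻¹(g(P))`, which therefore has `d` points
    -- and is unramified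
    have hfib {P} (hP : f.onPts P ∈ T₀) :
        {R ∈ f.onPts ⁻¹' (T₀ : Set D.Pt) | (geometricGraph f g).Adj R P} =
          f.onPts ⁻¹' {g.onPts P} :=
      (f.finite_fiber (g.onPts P)).eq_of_subset_of_encard_le' (fun R hR ↦ hR.2)
        (by rw [(h P hP).2, ← hf]; exact f.encard_fiber_le _)
    have hfg {P} (hP : f.onPts P ∈ T₀) : g.onPts P ∈ T₀ := by
      obtain ⟨Q, hQ⟩ := f.onPts_surjective (g.onPts P)
      exact hQ ▸ ((hfib hP).symm.subset (show Q ∈ f.onPts ⁻¹' {g.onPts P} from hQ)).1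
    -- every fibre of `f` above `T₀` is of this form
    have hf1 {P} (hP : f.onPts P ∈ T₀) : f.ramIdx P = 1 := by
      obtain ⟨Q, hQ⟩ := g.onPts_surjective (f.onPts P)
      have hfQ := hgf (hQ ▸ hP)
      refine (f.encard_fiber_eq_iff (g.onPts Q)).mp ?_ P hQ.symm
      rw [← hfib hfQ, hf]
      exact (h Q hfQ).2
    intro P
    by_cases hP : f.onPts P ∈ T₀
    · simp [hP, hfg hP, hf1 hP, hg1 (hfg hP)]
    · have hgP : g.onPts P ∉ T₀ := fun hgP ↦ hP (hgf hgP)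
      simp [hP, hgP]

/-- The relation `ρ ^ (t a) (φ ∘ f) ^ b ∼ (φ ∘ g) ^ b` says that `f^* div(T₀) = g^* div(T₀)`: the
contribution of `S₀` to the divisors of `φ ∘ f` and `φ ∘ g` cancels against the divisor of `ρ`. -/
theorem eqUpToConst_iff_pullback_setDiv_eq {S₀ T₀ : Finset D.Pt}
    (hS : f.onPts ⁻¹' (S₀ : Set D.Pt) = g.onPts ⁻¹' (S₀ : Set D.Pt)) {a b s t : ℕ} (ha : 0 < a)
    (hb : 0 < b) (hs : 0 < s) {ρ : C.FunField} (hρ : ρ ≠ 0)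
    (hρdiv : C.div ρ = ⇑(b • (f.different S₀ - g.different S₀))) {φ : D.FunField} (hφ : φ ≠ 0)
    (hφdiv : D.div φ = ⇑(a • (s • setDiv T₀ - t • setDiv S₀))) :
    EqUpToConst (ρ ^ (t * a) * f.comap φ ^ b) (g.comap φ ^ b) ↔
      ∀ P, (f.ramIdx P : ℤ) * setDiv T₀ (f.onPts P) = g.ramIdx P * setDiv T₀ (g.onPts P) := by
  classical
  have hf0 : f.comap φ ≠ 0 := by simpa using hφ
  have hg0 : g.comap φ ≠ 0 := by simpa using hφ
  rw [eqUpToConst_iff (mul_ne_zero (pow_ne_zero _ hρ) (pow_ne_zero _ hf0)) (pow_ne_zero _ hg0)]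
  refine forall_congr' fun P ↦ ?_
  have hSP : f.onPts P ∈ S₀ ↔ g.onPts P ∈ S₀ := Set.ext_iff.mp hS P
  -- the difference of the two divisors is `a b s (f^* div(T₀) - g^* div(T₀))`
  have hpos : (a * b * s : ℤ) ≠ 0 := by positivity
  rw [div_mul (pow_ne_zero _ hρ) (pow_ne_zero _ hf0), div_pow hρ, div_pow hf0, div_pow hg0,
    f.div_comap hφ, g.div_comap hφ, hρdiv, hφdiv, ← sub_eq_zero,
    ← sub_eq_zero (a := _ * setDiv T₀ _)]
  refine Iff.trans ?_ (mul_eq_zero_iff_left hpos)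
  simp only [Finsupp.smul_apply, Finsupp.sub_apply, f.different_apply, g.different_apply, hSP,
    setDiv_apply S₀, nsmul_eq_mul, Nat.cast_mul]
  refine Eq.congr_left ?_
  split_ifs <;> ring

end Regularity

end Curve

end RecursiveTower

end

theorem mainTheorem1 {k : Type u} [Field k] [Finite k]
    {X X₀ : RecursiveTower.Curve k} (f g : X.Map X₀) (d : ℕ)
    (hf : f.degree = d) (hg : g.degree = d)
    (S : Set X.Pt) (S₀ : Finset X₀.Pt)
    (hS : RecursiveTower.Curve.IsComplete f g S)
    (hSf : S = f.onPts ⁻¹' (S₀ : Set X₀.Pt)) (hSg : S = g.onPts ⁻¹' (S₀ : Set X₀.Pt))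
    (b : ℕ)
    (hb : RecursiveTower.Curve.HasOrderInJac (f.different S₀ - g.different S₀) b)
    (ρ : X.FunField) (hρ : ρ ≠ 0)
    (hρdiv : X.div ρ = ⇑(b • (f.different S₀ - g.different S₀)))
    (T₀ : Finset X₀.Pt) (hT₀ : Disjoint (T₀ : Set X₀.Pt) g.ramLocus)
    (s t : ℕ) (hs : 0 < s) (ht : 0 < t) (hst : t * S₀.card = s * T₀.card)
    (a : ℕ)
    (ha : RecursiveTower.Curve.HasOrderInJac
      (s • RecursiveTower.Curve.setDiv T₀ - t • RecursiveTower.Curve.setDiv S₀) a)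
    (φ : X₀.FunField) (hφ : φ ≠ 0)
    (hφdiv : X₀.div φ =
      ⇑(a • (s • RecursiveTower.Curve.setDiv T₀ - t • RecursiveTower.Curve.setDiv S₀))) :
    RecursiveTower.Curve.EqUpToConst (ρ ^ (t * a) * f.comap φ ^ b) (g.comap φ ^ b) ↔
      RecursiveTower.Curve.IsDRegular f g d (f.onPts ⁻¹' (T₀ : Set X₀.Pt)) :=
  (RecursiveTower.Curve.eqUpToConst_iff_pullback_setDiv_eq f g (hSf.symm.trans hSg) ha.1.1 hb.1.1 hs
    hρ hρdiv hφ hφdiv).trans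
    (RecursiveTower.Curve.pullback_setDiv_eq_iff_isDRegular f g hf hg hT₀)
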